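/- **Theorem (Concentration with centering).** Let $\mathcal B$ be the closed Euclidean unit ball of $\mathbb R^d$. For a symmetric positive-definite $\Sigma\in\mathbb R^{d\times d}$ with eigenvalues $\sigma_1^2\ge\dots\ge\sigma_d^2>0$, put $d_{\rm eff}(s)=\sum_{i=1}^d(\sigma_i/\sigma_1)^{2/s}$ for integers $s\ge1$. A random vector $a$ in $\mathbb R^d$ is called $\Sigma$-subgaussian if $$\mathbb P(|a^\top x|>t)\le 2\exp\Big(-\frac12\,\frac{t^2}{x^\top\Sigma x}\Big)\qquad\text{for all } t>0 \text{ and all nonzero } x\in\mathcal B.$$ For every integer $r\ge2$ there is a constant $C_r>0$, depending only on $r$, such that the following holds. Let $d,n\ge1$ be integers, let $\Sigma\in\mathbb R^{d\times d}$ be symmetric positive-definite, and let $a_1,\dots,a_n$ be i.i.d. $\Sigma$-subgaussian random vectors, with $a$ a further random vector of the same law. Let $f_1,\dots,f_r:\mathbb R\to\mathbb R$ be $1$-Lipschitz with $f_k(0)=0$ for $k=1,\dots,r$, and let $B_1,\dots,B_r>0$ be such that for all $k\in\{1,\dots,r\}$, $x\in\mathcal B$ and $i\in\{1,\dots,n\}$,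 $|f_k(a_i^\top x)|\le B_k$ almost surely. Put $B=B_1\cdots B_r$ and $$Z=\sup_{x_1,\dots,x_r\in\mathcal B}\ \frac1n\sum_{i=1}^n\Big(\prod_{k=1}^r f_k(a_i^\top x_k)-\mathbb E\Big[\prod_{k=1}^r f_k(a^\top x_k)\Big]\Big).$$ Then the expectations exist, the supremum is finite, and for every $\lambda>0$ (if $d=1$: for every $\lambda\ge1$), $$\mathbb P\left(Z\ge C_r\sigma_1^r\left(\frac1n\,\frac{\lambda+d_{\rm eff}(r)\ln d}{(\sigma_1^{-r}B)^{2/r-1}}+\frac{\sqrt\lambda+\sqrt{d_{\rm eff}(1)\ln d}}{\sqrt n}\right)\right)\le e^{-\lambda}.$$ -/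

import Mathlib

open MeasureTheory ProbabilityTheory
open scoped Matrix

noncomputable section

/-- Tail condition of a `S`-subgaussian random vector `a` in `ℝ^d`: for all `t > 0` and all `x` in
the closed Euclidean unit ball, `P(|aᵀx| > t) ≤ 2 exp(-(1/2) t² / (xᵀ S x))`.
(If `x = 0` the division by zero makes the right-hand side `2`, and the probability is `0`, so the
condition at `x = 0` is vacuous, as it should be.) -/
def IsSubgaussianVector {d : ℕ} (S : Matrix (Fin d) (Fin d) ℝ)
    {Ω : Type*} [MeasurableSpace Ω] (a : Ω → EuclideanSpace ℝ (Fin d)) (μ : Measure Ω) : Prop :=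
  ∀ t : ℝ, 0 < t → ∀ x : EuclideanSpace ℝ (Fin d), ‖x‖ ≤ 1 →
    μ.real {ω | t < |inner ℝ (a ω) x|}
      ≤ 2 * Real.exp (-(1 / 2) * (t ^ 2 / (x.ofLp ⬝ᵥ (S *ᵥ x.ofLp))))

/-- `σ₁`, the square root of the largest eigenvalue of a positive semidefinite matrix. -/
def sigmaMax {d : ℕ} {S : Matrix (Fin d) (Fin d) ℝ} (hS : S.PosSemidef) : ℝ :=
  √(⨆ i, hS.isHermitian.eigenvalues i)

/-- Effective dimension `d_eff(s) = ∑ᵢ (σᵢ / σ₁)^(2/s)`, where the `σᵢ²` are the eigenvalues of the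
positive semidefinite matrix `S`, counted with multiplicity. -/
def effDim {d : ℕ} {S : Matrix (Fin d) (Fin d) ℝ} (hS : S.PosSemidef) (s : ℕ) : ℝ :=
  ∑ i, (√(hS.isHermitian.eigenvalues i) / sigmaMax hS) ^ (2 / (s : ℝ))

/-- The index set of the supremum: `r`-tuples of points of the closed unit ball of `ℝ^d`. -/
abbrev BallTuple (r d : ℕ) : Type :=
  {x : Fin r → EuclideanSpace ℝ (Fin d) // ∀ k, ‖x k‖ ≤ 1}

/-- The centered empirical mean
`(1/n) ∑ᵢ (∏ₖ fₖ(aᵢᵀ xₖ) - E[∏ₖ fₖ(aᵀ xₖ)])` at a tuple `x = (x₁, …, x_r)`;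
here `a` is the generic copy and `A i` is the `i`-th sample. -/
def centeredMean {r d n : ℕ} {Ω : Type*} [MeasurableSpace Ω] (μ : Measure Ω)
    (f : Fin r → ℝ → ℝ) (a : Ω → EuclideanSpace ℝ (Fin d))
    (A : Fin n → Ω → EuclideanSpace ℝ (Fin d))
    (x : Fin r → EuclideanSpace ℝ (Fin d)) (ω : Ω) : ℝ :=
  (1 / (n : ℝ)) * ∑ i, (∏ k, f k (inner ℝ (A i ω) (x k))
    - ∫ ω', ∏ k, f k (inner ℝ (a ω') (x k)) ∂μ)

/-- The random variable `Z`: the supremum of `centeredMean` over `r`-tuples in the unit ball. -/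
def centeredSup {r d n : ℕ} {Ω : Type*} [MeasurableSpace Ω] (μ : Measure Ω)
    (f : Fin r → ℝ → ℝ) (a : Ω → EuclideanSpace ℝ (Fin d))
    (A : Fin n → Ω → EuclideanSpace ℝ (Fin d)) (ω : Ω) : ℝ :=
  ⨆ x : BallTuple r d, centeredMean μ f a A x.1 ω

end

/-! The proof is a chaining argument in which the increments have Bernstein tails and the nets are
adapted to the ellipsoid of `S`.

Take two tuples whose components are `δ`-close for the quadratic form of `S`. The difference `X` of
their products satisfies `X² ≤ K² Q^r`, where `K = r σ₁^(r-1) δ` and `Q` is a sum of squares of `3r`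
standardized linear forms of `a` (`sq_prod_sub_prod_le`). Thus `Q` has an exponential moment, while
`X` alone has tails too heavy for a moment generating function when `r > 2`. Boundedness repairs
this: writing `|X| = |X|^(1-2/r) |X|^(2/r)` and using `|X| ≤ 2B` on the first factor gives `|X| ≤ M
Q` with `M = (2B)^(1-2/r) K^(2/r)` (`abs_le_rpow_mul_of_sq_le`). So `X` is subexponential at scale
`M` with variance proxy of order `K²`, and Bernstein's inequality gives increments of size `K √(u/n)
+ M u/n` with probability at least `1 - e^(-u)` (`centeredMean_sub_tail`).

At scale `σ₁ 2^(-j)` only the axes longer than that scale contribute to the entropy `H_j`. Chaining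
therefore needs `∑ 2^(-j) √H_j` for the Gaussian part and `∑ 2^(-2j/r) H_j` for the exponential
part. Exchanging the sums over scales and axes bounds the second by a multiple of `d_eff(r)`.
Cauchy–Schwarz over about `log d` scales bounds the first by a multiple of `√(d_eff(1) (1 + ln d))`,
the finer scales being negligible (`exists_chaining_sums_le`).

The supremum is over an uncountable set, but the bad event is a countable union over links of the
nets, and `centeredMean` is sequentially continuous in the tuple for every `ω`. The event for `Z` is
only included in this union, so its measurability is not needed. -/

/-! ### Metric entropy of ellipsoids -/

/-- Volumetric bound on the size of a separated set in an ellipsoid whose semi-axes are at least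
the separation. -/
theorem card_le_of_separated_ellipsoid {ι : Type*} [Fintype ι] (σ : ι → ℝ) {ε : ℝ} (hε : 0 < ε)
    (hσ : ∀ i, ε ≤ σ i) (s : Finset (EuclideanSpace ℝ ι)) (hs : ∀ x ∈ s, ‖x‖ ≤ 1)
    (hsep : ∀ x ∈ s, ∀ y ∈ s, x ≠ y → ε ^ 2 ≤ ∑ i, (σ i * (x i - y i)) ^ 2) :
    (s.card : ℝ) ≤ ∏ i, (3 * σ i / ε) := by
  classical
  let μ : Measure (EuclideanSpace ℝ ι) := volume
  let D : EuclideanSpace ℝ ι →ₗ[ℝ] EuclideanSpace ℝ ι := Matrix.toEuclideanLin (Matrix.diagonal σ)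
  have hσ0 : ∀ i, 0 < σ i := fun i => hε.trans_le (hσ i)
  have hD : ∀ x i, D x i = σ i * x i := fun x i => by
    simp [D, Matrix.mulVec_diagonal, Matrix.toLpLin_apply]
  have hdet : LinearMap.det D = ∏ i, σ i := by
    simp [D, Matrix.toEuclideanLin_eq_toLin_orthonormal, LinearMap.det_toLin]
  have hdist : ∀ x ∈ s, ∀ y ∈ s, x ≠ y → ε ≤ dist (D x) (D y) := fun x hx y hy hxy => by
    have h := hsep x hx y hy hxy
    refine le_of_sq_le_sq ?_ dist_nonneg
    rw [EuclideanSpace.dist_eq, Real.sq_sqrt (by positivity)]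
    refine h.trans (le_of_eq (Finset.sum_congr rfl fun i _ => ?_))
    rw [Real.dist_eq, sq_abs, hD, hD, mul_sub]
  have hdisj : Set.Pairwise (s : Set (EuclideanSpace ℝ ι))
      (Function.onFun Disjoint fun c => Metric.ball (D c) (ε / 2)) := by
    intro x hx y hy hxy
    apply Metric.ball_disjoint_ball
    linarith [hdist x hx y hy hxy]
  -- Since every semi-axis is at least `ε`, `D⁻¹` sends a ball of radius `ε/2` into one of radius
  -- `1/2`. Volume comparison with radius `3/2` then gives the factor `3 σ i / ε` per axis.
  have hsub : (⋃ c ∈ s, Metric.ball (D c) (ε / 2)) ⊆ D '' Metric.closedBall (0 : EuclideanSpace ℝ ι) (3 / 2) := by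
    refine Set.iUnion₂_subset fun x hx w hw => ?_
    let v : EuclideanSpace ℝ ι := WithLp.toLp 2 fun i => (σ i)⁻¹ * (w i - D x i)
    refine ⟨x + v, ?_, ?_⟩
    · have hv : ‖v‖ ≤ 1 / 2 := by
        have h1 : ε * ‖v‖ ≤ ‖w - D x‖ := by
          refine le_of_sq_le_sq ?_ (norm_nonneg _)
          rw [mul_pow, EuclideanSpace.norm_sq_eq, EuclideanSpace.norm_sq_eq, Finset.mul_sum]
          refine Finset.sum_le_sum fun i _ => ?_
          simp only [v, Real.norm_eq_abs, sq_abs, PiLp.sub_apply, mul_pow]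
          rw [← mul_assoc, inv_pow, ← div_eq_mul_inv]
          refine mul_le_of_le_one_left (sq_nonneg _) ?_
          rw [div_le_one (by have := hσ0 i; positivity)]
          exact pow_le_pow_left₀ hε.le (hσ i) 2
        rw [Metric.mem_ball, dist_eq_norm] at hw
        nlinarith
      rw [mem_closedBall_zero_iff]
      linarith [norm_add_le x v, hs x hx]
    · ext i
      have := (hσ0 i).ne'
      rw [map_add, PiLp.add_apply, hD, hD]
      simp only [v, hD]
      field_simp
      ring
  have hvol := measure_mono (μ := μ) hsub
  rw [measure_biUnion_finset hdisj fun c _ => Metric.isOpen_ball.measurableSet,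
    Measure.addHaar_image_linearMap, hdet, Measure.addHaar_closedBall _ _ (by norm_num)] at hvol
  simp only [μ.addHaar_ball_of_pos _ (half_pos hε), Finset.sum_const, nsmul_eq_mul] at hvol
  rw [← mul_assoc, ← mul_assoc, ENNReal.mul_le_mul_iff_left
    (Metric.measure_ball_pos μ _ zero_lt_one).ne' measure_ball_lt_top.ne,
    ← ENNReal.ofReal_mul (abs_nonneg _)] at hvol
  have hreal := ENNReal.toReal_le_of_le_ofReal (by positivity) hvol
  rw [abs_of_pos (Finset.prod_pos fun i _ => hσ0 i), finrank_euclideanSpace, ENNReal.toReal_mul,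
    ENNReal.toReal_ofReal (by positivity), ENNReal.toReal_natCast, ← le_div_iff₀ (by positivity)]
    at hreal
  refine hreal.trans (le_of_eq ?_)
  rw [Finset.prod_div_distrib, Finset.prod_mul_distrib, Finset.prod_const, Finset.prod_const,
    Finset.card_univ, div_pow, div_pow]
  field_simp

/-- Metric entropy of an ellipsoid: a net of the unit ball for the seminorm with weights `σ`. -/
theorem exists_ellipsoid_net {d : ℕ} (b : OrthonormalBasis (Fin d) ℝ (EuclideanSpace ℝ (Fin d)))
    (σ : Fin d → ℝ) (hσ : ∀ i, 0 ≤ σ i) {ε : ℝ} (hε : 0 < ε) :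
    ∃ T : Finset (EuclideanSpace ℝ (Fin d)), (∀ y ∈ T, ‖y‖ ≤ 1) ∧
      (T.card : ℝ) ≤ ∏ i, (if ε < σ i then 3 * σ i / ε else 1) ∧
      ∀ x, ‖x‖ ≤ 1 → ∃ y ∈ T, ∑ i, (σ i * b.repr (x - y) i) ^ 2 ≤ (3 * ε) ^ 2 := by
  classical
  -- Separation is measured on the long axes only; the short ones are already below the resolution
  -- `ε`.
  let p : EuclideanSpace ℝ (Fin d) → ℝ := fun x =>
    ∑ i : {i // ε < σ i}, (σ i * b.repr x i) ^ 2
  let good : Finset (EuclideanSpace ℝ (Fin d)) → Prop := fun T =>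
    (∀ y ∈ T, ‖y‖ ≤ 1) ∧ ∀ x ∈ T, ∀ y ∈ T, x ≠ y → ε ^ 2 ≤ p (x - y)
  have hcard : ∀ T, good T → (T.card : ℝ) ≤ ∏ i, (if ε < σ i then 3 * σ i / ε else 1) := by
    rintro T ⟨hT1, hT2⟩
    let P : EuclideanSpace ℝ (Fin d) → EuclideanSpace ℝ {i // ε < σ i} := fun x =>
      WithLp.toLp 2 fun i => b.repr x i
    have hpP : ∀ x y, p (x - y) = ∑ i : {i // ε < σ i}, (σ i * (P x i - P y i)) ^ 2 := fun x y => by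
      simp [p, P]
    have hinj : Set.InjOn P T := by
      intro x hx y hy hxy
      by_contra hne
      have h1 := hT2 x hx y hy hne
      rw [hpP, hxy] at h1
      simp only [sub_self, mul_zero, ne_eq, OfNat.ofNat_ne_zero, not_false_eq_true, zero_pow,
        Finset.sum_const_zero] at h1
      nlinarith
    have h := card_le_of_separated_ellipsoid (fun i : {i // ε < σ i} => σ i) hε
      (fun i => i.2.le) (T.image P) ?_ ?_
    · rw [Finset.card_image_of_injOn hinj] at h
      refine h.trans (le_of_eq ?_)
      rw [Finset.prod_ite, Finset.prod_const_one, mul_one,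
        ← Finset.prod_subtype_eq_prod_filter, Finset.subtype_univ]
    · intro z hz
      obtain ⟨x, hx, rfl⟩ := Finset.mem_image.1 hz
      refine le_trans ?_ (hT1 x hx)
      refine le_of_sq_le_sq ?_ (norm_nonneg _)
      rw [← b.repr.norm_map x, EuclideanSpace.norm_sq_eq, EuclideanSpace.norm_sq_eq]
      simp only [P]
      rw [← Finset.subtype_univ,
        Finset.sum_subtype_eq_sum_filter (fun i => ‖b.repr x i‖ ^ 2)]
      exact Finset.sum_le_sum_of_subset_of_nonneg (Finset.filter_subset _ _)
        fun i _ _ => by positivity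
    · intro z hz w hw hzw
      obtain ⟨x, hx, rfl⟩ := Finset.mem_image.1 hz
      obtain ⟨y, hy, rfl⟩ := Finset.mem_image.1 hw
      rw [← hpP]
      exact hT2 x hx y hy fun h => hzw (by rw [h])
  -- A separated set of maximal cardinality exists because `hcard` bounds all of them; by maximality
  -- it is a net for `p`.
  obtain ⟨T, hT, hmax⟩ : ∃ T, good T ∧ ∀ T', good T' → T'.card ≤ T.card := by
    let N := ⌊∏ i, (if ε < σ i then 3 * σ i / ε else 1)⌋₊
    let Q : ℕ → Prop := fun k => ∃ T, good T ∧ T.card = k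
    have hQ0 : Q 0 := ⟨∅, ⟨by simp, by simp⟩, rfl⟩
    obtain ⟨T, hT, hTc⟩ := Nat.findGreatest_spec (P := Q) (Nat.zero_le N) hQ0
    exact ⟨T, hT, fun T' hT' => hTc ▸
      Nat.le_findGreatest (Nat.le_floor (hcard T' hT')) ⟨T', hT', rfl⟩⟩
  refine ⟨T, hT.1, hcard T hT, fun x hx => ?_⟩
  obtain ⟨y, hy, hxy⟩ : ∃ y ∈ T, p (x - y) ≤ ε ^ 2 := by
    by_contra! hcon
    have hxT : x ∉ T := fun h => by
      have := hcon x h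
      simp only [p, sub_self, map_zero, PiLp.zero_apply, mul_zero, ne_eq, OfNat.ofNat_ne_zero,
        not_false_eq_true, zero_pow, Finset.sum_const_zero] at this
      nlinarith
    have hp : ∀ u v, p (u - v) = p (v - u) := fun u v => by
      rw [← neg_sub v u]
      simp only [p, map_neg, PiLp.neg_apply, mul_neg, neg_sq]
    have hgood : good (insert x T) := by
      refine ⟨fun y hy => ?_, fun u hu v hv huv => ?_⟩
      · rcases Finset.mem_insert.1 hy with rfl | hy
        exacts [hx, hT.1 y hy]
      · rcases Finset.mem_insert.1 hu with hu | hu <;> rcases Finset.mem_insert.1 hv with hv | hv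
        · exact absurd (hu.trans hv.symm) huv
        · rw [hu]; exact (hcon v hv).le
        · rw [hv, hp]; exact (hcon u hu).le
        · exact hT.2 u hu v hv huv
    have := hmax _ hgood
    rw [Finset.card_insert_of_notMem hxT] at this
    omega
  -- The long axes cost `ε²` and the short ones at most `ε² ‖x - y‖² ≤ 4 ε²`; the total `5 ε²` is
  -- below `(3ε)²`.
  refine ⟨y, hy, ?_⟩
  have hsplit : ∑ i, (σ i * b.repr (x - y) i) ^ 2 ≤
      p (x - y) + ∑ i, ε ^ 2 * (b.repr (x - y) i) ^ 2 := by
    have : p (x - y) = ∑ i, if ε < σ i then (σ i * b.repr (x - y) i) ^ 2 else 0 := by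
      simp only [p]
      rw [← Finset.sum_filter, ← Finset.subtype_univ,
        Finset.sum_subtype_eq_sum_filter (fun i => (σ i * b.repr (x - y) i) ^ 2)]
    rw [this, ← Finset.sum_add_distrib]
    refine Finset.sum_le_sum fun i _ => ?_
    split_ifs with h
    · linarith [mul_nonneg (sq_nonneg ε) (sq_nonneg (b.repr (x - y) i))]
    · rw [zero_add, mul_pow]
      exact mul_le_mul_of_nonneg_right (pow_le_pow_left₀ (hσ i) (not_lt.1 h) 2) (sq_nonneg _)
  have hnorm : ∑ i, (b.repr (x - y) i) ^ 2 ≤ 2 ^ 2 := by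
    have h1 : ∑ i, (b.repr (x - y) i) ^ 2 = ‖x - y‖ ^ 2 := by
      rw [← b.repr.norm_map (x - y), EuclideanSpace.norm_sq_eq]
      simp
    rw [h1]
    exact pow_le_pow_left₀ (norm_nonneg _)
      ((norm_sub_le x y).trans (by linarith [hT.1 y hy])) 2
  rw [← Finset.mul_sum] at hsplit
  nlinarith [sq_nonneg ε]

/-! ### Exponential moments of subgaussian forms -/

/-- Layer-cake formula: the tail of `g² / 4` at `t` is at most `2 e^(-2t)`, which leaves `2 e^(-t)`
after multiplication by `e^t`. The integral is `2`, and the remaining `1` is the value of the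
exponential at `0`. -/
theorem lintegral_exp_sq_le {Ω : Type*} [MeasurableSpace Ω] {μ : Measure Ω} [IsProbabilityMeasure μ]
    {g : Ω → ℝ} (hg : AEMeasurable g μ)
    (htail : ∀ t : ℝ, 0 < t → μ.real {ω | t < |g ω|} ≤ 2 * Real.exp (-(t ^ 2 / 2))) :
    ∫⁻ ω, ENNReal.ofReal (Real.exp (g ω ^ 2 / 4)) ∂μ ≤ 3 := by
  have hlc := lintegral_comp_eq_lintegral_meas_lt_mul (μ := μ) (f := fun ω => g ω ^ 2 / 4)
    (g := Real.exp) (Filter.Eventually.of_forall fun ω => by positivity)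
    ((hg.pow_const 2).div_const 4) (fun t _ => Real.continuous_exp.intervalIntegrable 0 t)
    (Filter.Eventually.of_forall fun t => (Real.exp_pos t).le)
  have hset : ∀ t : ℝ, 0 < t → μ {ω | t < g ω ^ 2 / 4} * ENNReal.ofReal (Real.exp t)
      ≤ ENNReal.ofReal (2 * Real.exp (-t)) := fun t ht => by
    have h1 : {ω | t < g ω ^ 2 / 4} = {ω | 2 * √t < |g ω|} := by
      ext ω
      simp only [Set.mem_ofPred_eq]
      rw [← sq_lt_sq₀ (a := 2 * √t) (by positivity) (abs_nonneg _), sq_abs, mul_pow, Real.sq_sqrt ht.le]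
      constructor <;> intro h <;> linarith
    have h2 := htail (2 * √t) (by positivity)
    rw [← h1, mul_pow, Real.sq_sqrt ht.le] at h2
    rw [← ofReal_measureReal, ← ENNReal.ofReal_mul measureReal_nonneg]
    refine ENNReal.ofReal_le_ofReal ?_
    calc _ ≤ 2 * Real.exp (-(2 ^ 2 * t / 2)) * Real.exp t := by gcongr
      _ = 2 * Real.exp (-t) := by rw [mul_assoc, ← Real.exp_add]; ring_nf
  have hint : ∫⁻ t in Set.Ioi (0 : ℝ), ENNReal.ofReal (2 * Real.exp (-t)) = 2 := by
    rw [← ofReal_integral_eq_lintegral_ofReal]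
    · rw [integral_const_mul, integral_exp_neg_Ioi_zero]; simp
    · exact (integrableOn_exp_neg_Ioi 0).const_mul 2
    · exact Filter.Eventually.of_forall fun t => by positivity
  have hle : ∫⁻ ω, ENNReal.ofReal (∫ t in (0 : ℝ)..(g ω ^ 2 / 4), Real.exp t) ∂μ ≤ 2 := by
    rw [hlc, ← hint]
    exact setLIntegral_mono (by fun_prop) fun t ht => hset t ht
  calc ∫⁻ ω, ENNReal.ofReal (Real.exp (g ω ^ 2 / 4)) ∂μ
      = ∫⁻ ω, (ENNReal.ofReal (∫ t in (0 : ℝ)..(g ω ^ 2 / 4), Real.exp t) + 1) ∂μ := by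
        refine lintegral_congr fun ω => ?_
        rw [integral_exp, ← ENNReal.ofReal_one, ← ENNReal.ofReal_add _ zero_le_one]
        · simp
        · have : 0 ≤ g ω ^ 2 / 4 := by positivity
          simpa using this
    _ ≤ 2 + 1 := by
        rw [lintegral_add_right _ measurable_const]
        simpa using hle
    _ = 3 := by norm_num

/-- The defining tail condition is imposed only on the unit ball, but it is homogeneous, so
normalizing `x` extends it to all vectors. -/
theorem IsSubgaussianVector.tail_div {d : ℕ} {S : Matrix (Fin d) (Fin d) ℝ} (hS : S.PosDef)
    {Ω : Type*} [MeasurableSpace Ω] {μ : Measure Ω} {a : Ω → EuclideanSpace ℝ (Fin d)}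
    (ha : IsSubgaussianVector S a μ) (x : EuclideanSpace ℝ (Fin d)) {τ : ℝ} (hτ : 0 < τ)
    (hx : x.ofLp ⬝ᵥ (S *ᵥ x.ofLp) ≤ τ ^ 2) {t : ℝ} (ht : 0 < t) :
    μ.real {ω | t < |inner ℝ (a ω) x / τ|} ≤ 2 * Real.exp (-(t ^ 2 / 2)) := by
  rcases eq_or_ne x 0 with rfl | hx0
  · simp only [inner_zero_right, zero_div, abs_zero, not_lt.2 ht.le, Set.ofPred_false,
      measureReal_empty]
    positivity
  have hn : 0 < ‖x‖ := norm_pos_iff.2 hx0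
  have hpos : 0 < x.ofLp ⬝ᵥ (S *ᵥ x.ofLp) := by
    have := hS.dotProduct_mulVec_pos (x := x.ofLp) (by simpa using hx0)
    simpa using this
  have h := ha (t * τ / ‖x‖) (by positivity) (‖x‖⁻¹ • x) (by rw [norm_smul]; simp [hn.ne'])
  have hset : {ω | t * τ / ‖x‖ < |inner ℝ (a ω) (‖x‖⁻¹ • x)|} = {ω | t < |inner ℝ (a ω) x / τ|} := by
    ext ω
    simp only [Set.mem_ofPred_eq, inner_smul_right, abs_mul, abs_div, abs_of_pos hτ, abs_inv,
      abs_norm]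
    rw [lt_div_iff₀ hτ, div_lt_iff₀ hn]
    field_simp
  rw [hset] at h
  refine h.trans ?_
  simp only [WithLp.ofLp_smul, Matrix.mulVec_smul, smul_dotProduct, dotProduct_smul, smul_eq_mul]
  gcongr 2 * Real.exp ?_
  set w := x.ofLp ⬝ᵥ (S *ᵥ x.ofLp)
  have : (t * τ / ‖x‖) ^ 2 / (‖x‖⁻¹ * (‖x‖⁻¹ * w)) = t ^ 2 * (τ ^ 2 / w) := by field_simp
  rw [this]
  have : 1 ≤ τ ^ 2 / w := (one_le_div hpos).2 hx
  nlinarith [sq_nonneg t]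

/-! ### Moment generating functions and Bernstein's inequality -/

theorem Real.exp_le_one_add_add_sq_mul_exp_abs (x : ℝ) :
    Real.exp x ≤ 1 + x + x ^ 2 * Real.exp |x| := by
  have h := Complex.norm_exp_sub_sum_le_norm_mul_exp (x : ℂ) 2
  simp only [Finset.sum_range_succ, Finset.sum_range_zero, pow_zero, Nat.factorial, Nat.cast_one,
    div_one, zero_add, pow_one, Nat.succ_eq_add_one, mul_one] at h
  have h2 : (Complex.exp x - (1 + x)) = ((Real.exp x - (1 + x) : ℝ) : ℂ) := by push_cast; rfl
  rw [h2, Complex.norm_real, Complex.norm_real, Real.norm_eq_abs, Real.norm_eq_abs, sq_abs] at h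
  linarith [le_abs_self (Real.exp x - (1 + x))]

section
variable {Ω : Type*} [MeasurableSpace Ω] {μ : Measure Ω}

/-- By convexity, the exponential of an average is at most the average of the exponentials. This
needs no independence among the `g i`, at the price of dividing by their number. -/
theorem lintegral_exp_sum_sq_le [IsProbabilityMeasure μ] {ι : Type*} [Fintype ι] [Nonempty ι]
    {g : ι → Ω → ℝ} (hg : ∀ i, AEMeasurable (g i) μ)
    (htail : ∀ i, ∀ t : ℝ, 0 < t → μ.real {ω | t < |g i ω|} ≤ 2 * Real.exp (-(t ^ 2 / 2))) :
    ∫⁻ ω, ENNReal.ofReal (Real.exp ((4 * Fintype.card ι : ℝ)⁻¹ * ∑ i, g i ω ^ 2)) ∂μ ≤ 3 := by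
  have hN : (0 : ℝ) < Fintype.card ι := by exact_mod_cast Fintype.card_pos
  have hconv : ∀ ω, Real.exp ((4 * Fintype.card ι : ℝ)⁻¹ * ∑ i, g i ω ^ 2) ≤
      ∑ i, (Fintype.card ι : ℝ)⁻¹ * Real.exp (g i ω ^ 2 / 4) := fun ω => by
    have := convexOn_exp.map_sum_le (t := Finset.univ) (w := fun _ : ι => (Fintype.card ι : ℝ)⁻¹)
      (p := fun i => g i ω ^ 2 / 4) (fun _ _ => by positivity)
      (by simp [hN.ne']) (fun _ _ => Set.mem_univ _)
    simp only [smul_eq_mul] at this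
    refine le_trans (le_of_eq ?_) this
    congr 1
    rw [Finset.mul_sum]
    exact Finset.sum_congr rfl fun i _ => by field_simp
  calc _ ≤ ∫⁻ ω, ∑ i, ENNReal.ofReal (Fintype.card ι : ℝ)⁻¹ *
        ENNReal.ofReal (Real.exp (g i ω ^ 2 / 4)) ∂μ := by
        refine lintegral_mono fun ω => (ENNReal.ofReal_le_ofReal (hconv ω)).trans (le_of_eq ?_)
        rw [ENNReal.ofReal_sum_of_nonneg fun _ _ => by positivity]
        exact Finset.sum_congr rfl fun i _ => ENNReal.ofReal_mul (by positivity)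
    _ = ∑ i, ENNReal.ofReal (Fintype.card ι : ℝ)⁻¹ *
        ∫⁻ ω, ENNReal.ofReal (Real.exp (g i ω ^ 2 / 4)) ∂μ := by
        rw [lintegral_finsetSum' _ fun i _ => by have := hg i; fun_prop]
        exact Finset.sum_congr rfl fun i _ => lintegral_const_mul' _ _ ENNReal.ofReal_ne_top
    _ ≤ ∑ _i : ι, ENNReal.ofReal (Fintype.card ι : ℝ)⁻¹ * 3 := by
        gcongr with i
        exact lintegral_exp_sq_le (hg i) (htail i)
    _ = 3 := by
        rw [Finset.sum_const, nsmul_eq_mul, ← mul_assoc, Finset.card_univ,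
          ENNReal.ofReal_inv_of_pos hN, ENNReal.ofReal_natCast, ENNReal.mul_inv_cancel, one_mul]
        · exact_mod_cast Fintype.card_ne_zero
        · exact ENNReal.natCast_ne_top _

/-- Moment generating function of a variable dominated both by `M Q` and by `K Q ^ (r / 2)`, where
`Q` has an exponential moment. -/
theorem mgf_le_of_dominated [IsProbabilityMeasure μ] {X Q : Ω → ℝ} (hX : Integrable X μ)
    (hQ : AEMeasurable Q μ) (r : ℕ) {K M c θ : ℝ} (hc : 0 < c) (hθ : 0 ≤ θ)
    (hQ0 : ∀ ω, 0 ≤ Q ω) (hXK : ∀ ω, X ω ^ 2 ≤ K ^ 2 * Q ω ^ r)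
    (hXM : ∀ᵐ ω ∂μ, |X ω| ≤ M * Q ω)
    (hexp : ∫⁻ ω, ENNReal.ofReal (Real.exp (c * Q ω)) ∂μ ≤ 3) (hθM : θ * M ≤ c / 2) :
    Integrable (fun ω => Real.exp (θ * X ω)) μ ∧
    mgf X μ θ ≤ Real.exp (θ * ∫ ω, X ω ∂μ + θ ^ 2 * (K ^ 2 * (3 * (r.factorial * (2 / c) ^ r)))) := by
  have hmeas : AEStronglyMeasurable (fun ω => Real.exp (c * Q ω)) μ :=
    (hQ.const_mul c).exp.aestronglyMeasurable
  have hint : Integrable (fun ω => Real.exp (c * Q ω)) μ := by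
    refine ⟨hmeas, ?_⟩
    rw [hasFiniteIntegral_iff_ofReal (Filter.Eventually.of_forall fun ω => (Real.exp_pos _).le)]
    exact hexp.trans_lt (by norm_num)
  have hint3 : ∫ ω, Real.exp (c * Q ω) ∂μ ≤ 3 := by
    rw [integral_eq_lintegral_of_nonneg_ae
      (Filter.Eventually.of_forall fun ω => (Real.exp_pos _).le) hmeas]
    exact ENNReal.toReal_mono (by norm_num) hexp
  have habs : ∀ᵐ ω ∂μ, |θ * X ω| ≤ c / 2 * Q ω := by
    filter_upwards [hXM] with ω hω
    rw [abs_mul, abs_of_nonneg hθ]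
    calc θ * |X ω| ≤ θ * (M * Q ω) := by gcongr
      _ = (θ * M) * Q ω := by ring
      _ ≤ _ := mul_le_mul_of_nonneg_right hθM (hQ0 ω)
  have hθX : Integrable (fun ω => Real.exp (θ * X ω)) μ := by
    refine hint.mono' ((hX.aemeasurable.const_mul θ).exp.aestronglyMeasurable) ?_
    filter_upwards [habs] with ω hω
    rw [Real.norm_eq_abs, abs_of_pos (Real.exp_pos _)]
    refine Real.exp_le_exp.2 ((le_abs_self _).trans (hω.trans ?_))
    nlinarith [hQ0 ω]
  refine ⟨hθX, ?_⟩
  -- The exponent `c Q` is spent in two halves: one absorbs the polynomial `Q ^ r` coming from `X²`,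
  -- the other the factor `exp |θ X|`.
  set D : ℝ := r.factorial * (2 / c) ^ r with hD
  have hD0 : 0 ≤ D := by positivity
  have hpt : ∀ᵐ ω ∂μ, Real.exp (θ * X ω) ≤
      1 + θ * X ω + θ ^ 2 * K ^ 2 * D * Real.exp (c * Q ω) := by
    filter_upwards [habs] with ω hω
    have h1 := Real.exp_le_one_add_add_sq_mul_exp_abs (θ * X ω)
    have h2 : Q ω ^ r ≤ D * Real.exp (c / 2 * Q ω) := by
      have := Real.pow_div_factorial_le_exp (x := c / 2 * Q ω)
        (mul_nonneg (by positivity) (hQ0 ω)) r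
      rw [div_le_iff₀ (by positivity)] at this
      calc Q ω ^ r = (2 / c) ^ r * (c / 2 * Q ω) ^ r := by
            rw [← mul_pow]; congr 1; field_simp
        _ ≤ (2 / c) ^ r * (Real.exp (c / 2 * Q ω) * r.factorial) := by gcongr
        _ = _ := by rw [hD]; ring
    have h3 : (θ * X ω) ^ 2 * Real.exp |θ * X ω| ≤ θ ^ 2 * K ^ 2 * D * Real.exp (c * Q ω) := by
      calc (θ * X ω) ^ 2 * Real.exp |θ * X ω|
          ≤ (θ ^ 2 * (K ^ 2 * (D * Real.exp (c / 2 * Q ω)))) * Real.exp (c / 2 * Q ω) := by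
            rw [mul_pow]
            gcongr
            exact (hXK ω).trans (by gcongr)
        _ = θ ^ 2 * K ^ 2 * D * (Real.exp (c / 2 * Q ω) * Real.exp (c / 2 * Q ω)) := by ring
        _ = _ := by rw [← Real.exp_add]; ring_nf
    linarith
  have hi1 : Integrable (fun ω => 1 + θ * X ω) μ := (integrable_const 1).add (hX.const_mul θ)
  have hi2 : Integrable (fun ω => θ ^ 2 * K ^ 2 * D * Real.exp (c * Q ω)) μ := hint.const_mul _
  calc mgf X μ θ ≤ ∫ ω, (1 + θ * X ω + θ ^ 2 * K ^ 2 * D * Real.exp (c * Q ω)) ∂μ :=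
        integral_mono_ae hθX (hi1.add hi2) hpt
    _ = 1 + θ * ∫ ω, X ω ∂μ + θ ^ 2 * K ^ 2 * D * ∫ ω, Real.exp (c * Q ω) ∂μ := by
        rw [integral_add hi1 hi2, integral_add (integrable_const 1) (hX.const_mul θ),
          integral_const_mul, integral_const_mul]
        simp
    _ ≤ 1 + θ * ∫ ω, X ω ∂μ + θ ^ 2 * K ^ 2 * D * 3 := by gcongr
    _ = θ * ∫ ω, X ω ∂μ + θ ^ 2 * (K ^ 2 * (3 * D)) + 1 := by ring
    _ ≤ _ := Real.add_one_le_exp _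

/-- Bernstein's inequality for i.i.d. variables, from a bound on the moment generating function. -/
theorem bernstein_of_mgf_le [IsProbabilityMeasure μ] {n : ℕ} (hn : 1 ≤ n) {Y : Fin n → Ω → ℝ}
    {X : Ω → ℝ} (hindep : iIndepFun Y μ) (hident : ∀ i, IdentDistrib (Y i) X μ μ) {V θ₀ u : ℝ}
    (hV : 0 < V) (hθ₀ : 0 < θ₀) (hu : 0 < u)
    (hmgf : ∀ θ, 0 ≤ θ → θ ≤ θ₀ → Integrable (fun ω => Real.exp (θ * X ω)) μ ∧
      mgf X μ θ ≤ Real.exp (θ * ∫ ω, X ω ∂μ + θ ^ 2 * V)) :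
    μ.real {ω | 2 * √(u * V / n) + 2 * u / (n * θ₀) ≤
      (1 / (n : ℝ)) * ∑ i, (Y i ω - ∫ ω', X ω' ∂μ)} ≤ Real.exp (-u) := by
  have hn0 : (0 : ℝ) < n := by exact_mod_cast hn
  set m := ∫ ω', X ω' ∂μ
  set t := 2 * √(u * V / n) + 2 * u / (n * θ₀) with ht
  have hYm : ∀ i, AEMeasurable (Y i) μ := fun i => (hident i).aemeasurable_fst
  have key : ∀ θ, 0 ≤ θ → θ ≤ θ₀ → μ.real {ω | t ≤ (1 / (n : ℝ)) * ∑ i, (Y i ω - m)} ≤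
      Real.exp (-(n * θ * t) + n * θ ^ 2 * V) := fun θ h0 h1 => by
    obtain ⟨hi, hm⟩ := hmgf θ h0 h1
    have hiY : ∀ i, Integrable (fun ω => Real.exp (θ * Y i ω)) μ := fun i =>
      (((hident i).comp (u := fun x => Real.exp (θ * x)) (by fun_prop)).integrable_iff).2 hi
    have hset : {ω | t ≤ (1 / (n : ℝ)) * ∑ i, (Y i ω - m)} =
        {ω | n * t + n * m ≤ (∑ i, Y i) ω} := by
      ext ω
      simp only [Set.mem_ofPred_eq, Finset.sum_sub_distrib, Finset.sum_const, Finset.card_univ,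
        Fintype.card_fin, nsmul_eq_mul, Finset.sum_apply]
      rw [one_div, ← div_eq_inv_mul, le_div_iff₀ hn0]
      constructor <;> intro h <;> linarith
    rw [hset]
    have hsum : Integrable (fun ω => Real.exp (θ * (∑ i, Y i) ω)) μ := by
      have hae : ∀ i, Y i =ᵐ[μ] (hYm i).mk := fun i => (hYm i).ae_eq_mk
      have h := (hindep.congr hae).integrable_exp_mul_sum (t := θ) (s := Finset.univ)
        (fun i => (hYm i).measurable_mk) fun i _ => (hiY i).congr
          ((hae i).fun_comp fun x => Real.exp (θ * x))
      refine h.congr ?_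
      filter_upwards [Filter.eventually_all.2 hae] with ω hω
      simp only [Finset.sum_apply, hω]
    refine (measure_ge_le_exp_mul_mgf _ h0 hsum).trans ?_
    rw [hindep.mgf_sum₀ hYm]
    have hprod : ∏ i, mgf (Y i) μ θ ≤ Real.exp (θ * m + θ ^ 2 * V) ^ n := by
      rw [show Real.exp (θ * m + θ ^ 2 * V) ^ n = ∏ _i : Fin n, Real.exp (θ * m + θ ^ 2 * V) by simp]
      refine Finset.prod_le_prod (fun i _ => mgf_nonneg) fun i _ => ?_
      rw [mgf_congr_of_identDistrib _ _ (hident i)]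
      simpa using hm
    refine (mul_le_mul_of_nonneg_left hprod (Real.exp_pos _).le).trans (le_of_eq ?_)
    rw [← Real.exp_nat_mul, ← Real.exp_add]
    ring_nf
  -- The unconstrained choice `θ = √(u / (n V))` is used when admissible, and `θ₀` otherwise. In
  -- both cases the linear term contributes at most `-2u` and the quadratic one at most `u`.
  rcases le_total (√(u / (n * V))) θ₀ with h | h
  · refine (key _ (Real.sqrt_nonneg _) h).trans (Real.exp_le_exp.2 ?_)
    have hs : √(u / (n * V)) * √(u * V / n) = u / n := by
      rw [← Real.sqrt_mul (by positivity), show u / (n * V) * (u * V / n) = (u / n) ^ 2 by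
        field_simp, Real.sqrt_sq (by positivity)]
    rw [Real.sq_sqrt (by positivity)]
    have h2 : (n : ℝ) * √(u / (n * V)) * t ≥ 2 * u := by
      calc (n : ℝ) * √(u / (n * V)) * t
          ≥ n * √(u / (n * V)) * (2 * √(u * V / n)) := by
            gcongr; rw [ht]; have : 0 ≤ 2 * u / (n * θ₀) := by positivity
            linarith
        _ = 2 * n * (√(u / (n * V)) * √(u * V / n)) := by ring
        _ = 2 * u := by rw [hs]; field_simp
    have h3 : (n : ℝ) * (u / (n * V)) * V = u := by field_simp
    linarith
  · refine (key _ hθ₀.le le_rfl).trans (Real.exp_le_exp.2 ?_)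
    have h1 : θ₀ ^ 2 ≤ u / (n * V) := (Real.le_sqrt hθ₀.le (by positivity)).1 h
    rw [le_div_iff₀ (by positivity)] at h1
    have h2 : (n : ℝ) * θ₀ * t ≥ 2 * u := by
      calc (n : ℝ) * θ₀ * t ≥ n * θ₀ * (2 * u / (n * θ₀)) := by
            gcongr; rw [ht]; have := Real.sqrt_nonneg (u * V / n); linarith
        _ = 2 * u := by field_simp
    nlinarith
end

/-! ### Increments of products of Lipschitz functions -/

/-- Replace the factors one at a time. For empty `s` the truncated exponent is harmless, its
coefficient being zero. -/
theorem Finset.abs_prod_sub_prod_le {ι : Type*} (s : Finset ι) (a b : ι → ℝ) {R δ : ℝ}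
    (hR : 0 ≤ R) (ha : ∀ i ∈ s, |a i| ≤ R) (hb : ∀ i ∈ s, |b i| ≤ R)
    (hab : ∀ i ∈ s, |a i - b i| ≤ δ) :
    |∏ i ∈ s, a i - ∏ i ∈ s, b i| ≤ s.card * R ^ (s.card - 1) * δ := by
  classical
  induction s using Finset.induction_on with
  | empty => simp
  | insert i s hi ih =>
    have hδ : 0 ≤ δ := (abs_nonneg _).trans (hab i (Finset.mem_insert_self i s))
    have h := ih (fun j hj => ha j (Finset.mem_insert_of_mem hj))
      (fun j hj => hb j (Finset.mem_insert_of_mem hj))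
      fun j hj => hab j (Finset.mem_insert_of_mem hj)
    have hp : |∏ j ∈ s, b j| ≤ R ^ s.card := by
      rw [Finset.abs_prod, ← Finset.prod_const]
      exact Finset.prod_le_prod (fun _ _ => abs_nonneg _)
        fun j hj => hb j (Finset.mem_insert_of_mem hj)
    rw [Finset.prod_insert hi, Finset.prod_insert hi, Finset.card_insert_of_notMem hi,
      show a i * ∏ j ∈ s, a j - b i * ∏ j ∈ s, b j =
        a i * (∏ j ∈ s, a j - ∏ j ∈ s, b j) + (a i - b i) * ∏ j ∈ s, b j by ring]
    calc _ ≤ |a i| * |∏ j ∈ s, a j - ∏ j ∈ s, b j| + |a i - b i| * |∏ j ∈ s, b j| := by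
          rw [← abs_mul, ← abs_mul]; exact abs_add_le _ _
      _ ≤ R * (s.card * R ^ (s.card - 1) * δ) + δ * R ^ s.card := by
          gcongr
          exacts [ha i (Finset.mem_insert_self i s), hab i (Finset.mem_insert_self i s)]
      _ = _ := by
          rcases Nat.eq_zero_or_pos s.card with h0 | h0
          · simp [h0]
          · obtain ⟨m, hm⟩ := Nat.exists_eq_succ_of_ne_zero h0.ne'
            simp only [hm, Nat.succ_eq_add_one, Nat.add_sub_cancel]
            push_cast
            ring

/-- Interpolation: the power `2/r` of `|x|` is linear in `q`, and the complementary power is bounded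
by `b`. This is where `r ≥ 2` and the exponent `2/r - 1` of the theorem enter. -/
theorem abs_le_rpow_mul_of_sq_le {r : ℕ} (hr : 2 ≤ r) {x b K q : ℝ} (hK : 0 ≤ K) (hq : 0 ≤ q)
    (hb : |x| ≤ b) (hx : x ^ 2 ≤ K ^ 2 * q ^ r) :
    |x| ≤ b ^ (1 - 2 / (r : ℝ)) * K ^ (2 / (r : ℝ)) * q := by
  have hr0 : (0 : ℝ) < r := by positivity
  have h1 : 0 ≤ 1 - 2 / (r : ℝ) := by
    rw [sub_nonneg, div_le_one hr0]; exact_mod_cast hr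
  have h2 : |x| ^ (2 / (r : ℝ)) ≤ K ^ (2 / (r : ℝ)) * q := by
    have h3 : |x| ^ (2 / (r : ℝ)) = (x ^ 2) ^ (1 / (r : ℝ)) := by
      rw [← sq_abs, ← Real.rpow_natCast, ← Real.rpow_mul (abs_nonneg _)]
      congr 1; push_cast; ring
    have h4 : (K ^ 2 * q ^ r) ^ (1 / (r : ℝ)) = K ^ (2 / (r : ℝ)) * q := by
      rw [Real.mul_rpow (by positivity) (by positivity), ← Real.rpow_natCast K,
        ← Real.rpow_natCast q, ← Real.rpow_mul hK, ← Real.rpow_mul hq, mul_one_div_cancel hr0.ne',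
        Real.rpow_one]
      congr 2; push_cast; ring
    rw [h3, ← h4]
    exact Real.rpow_le_rpow (sq_nonneg _) hx (by positivity)
  calc |x| = |x| ^ (1 - 2 / (r : ℝ)) * |x| ^ (2 / (r : ℝ)) := by
        rw [← Real.rpow_add_of_nonneg (abs_nonneg _) h1 (by positivity)]; simp
    _ ≤ b ^ (1 - 2 / (r : ℝ)) * (K ^ (2 / (r : ℝ)) * q) := by
        have hb0 : 0 ≤ b := (abs_nonneg _).trans hb
        gcongr
    _ = _ := by ring

section
variable {r d n : ℕ} {Ω : Type*} [MeasurableSpace Ω] {μ : Measure Ω}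
  {f : Fin r → ℝ → ℝ} {a : Ω → EuclideanSpace ℝ (Fin d)} {A : Fin n → Ω → EuclideanSpace ℝ (Fin d)}
  {B : Fin r → ℝ}

theorem sq_prod_sub_prod_le (hr : 1 ≤ r) (hLip : ∀ k, LipschitzWith 1 (f k))
    (hf0 : ∀ k, f k 0 = 0) {s δ q : ℝ} (hs : 0 < s) (hδ : 0 < δ) (hq : 0 ≤ q) (y z : Fin r → ℝ)
    (hy : ∀ k, (s⁻¹ * y k) ^ 2 ≤ q) (hz : ∀ k, (s⁻¹ * z k) ^ 2 ≤ q)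
    (hyz : ∀ k, (δ⁻¹ * (y k - z k)) ^ 2 ≤ q) :
    (∏ k, f k (y k) - ∏ k, f k (z k)) ^ 2 ≤ (r * s ^ (r - 1) * δ) ^ 2 * q ^ r := by
  have hbound : ∀ {c x : ℝ}, 0 < c → (c⁻¹ * x) ^ 2 ≤ q → |x| ≤ c * √q := fun {c x} hc h => by
    have h1 := Real.abs_le_sqrt h
    rw [abs_mul, abs_inv, abs_of_pos hc, inv_mul_le_iff₀ hc] at h1
    exact h1
  have hfd : ∀ k u v, |f k u - f k v| ≤ |u - v| := fun k u v => by
    simpa [Real.dist_eq] using (hLip k).dist_le_mul u v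
  have hf : ∀ k u, |f k u| ≤ |u| := fun k u => by simpa [hf0] using hfd k u 0
  have h := Finset.abs_prod_sub_prod_le Finset.univ (fun k => f k (y k)) (fun k => f k (z k))
    (R := s * √q) (δ := δ * √q) (by positivity) (fun k _ => (hf k _).trans (hbound hs (hy k)))
    (fun k _ => (hf k _).trans (hbound hs (hz k)))
    (fun k _ => (hfd k _ _).trans (hbound hδ (hyz k)))
  rw [Finset.card_univ, Fintype.card_fin] at h
  rw [← sq_abs]
  refine (pow_le_pow_left₀ (abs_nonneg _) h 2).trans (le_of_eq ?_)
  obtain ⟨m, rfl⟩ := Nat.exists_eq_add_of_le' hr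
  rw [Nat.add_sub_cancel, show (((m + 1 : ℕ) : ℝ) * (s * √q) ^ m * (δ * √q)) ^ 2 =
    (((m + 1 : ℕ) : ℝ) * s ^ m * δ) ^ 2 * (√q ^ 2) ^ (m + 1) by ring, Real.sq_sqrt hq]

theorem ae_abs_prod_le (hn : 1 ≤ n) (hident : ∀ i, IdentDistrib (A i) a μ μ)
    (hLip : ∀ k, LipschitzWith 1 (f k))
    (hB : ∀ k, ∀ x : EuclideanSpace ℝ (Fin d), ‖x‖ ≤ 1 →
      ∀ i, ∀ᵐ ω ∂μ, |f k (inner ℝ (A i ω) x)| ≤ B k)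
    (x : Fin r → EuclideanSpace ℝ (Fin d)) (hx : ∀ k, ‖x k‖ ≤ 1) :
    ∀ᵐ ω ∂μ, |∏ k, f k (inner ℝ (a ω) (x k))| ≤ ∏ k, B k := by
  have h : ∀ k, ∀ᵐ ω ∂μ, |f k (inner ℝ (a ω) (x k))| ≤ B k := fun k => by
    have hf := (hLip k).continuous
    refine (hident ⟨0, hn⟩).ae_snd (p := fun v => |f k (inner ℝ v (x k))| ≤ B k) ?_
      (hB k (x k) (hx k) ⟨0, hn⟩)
    exact (isClosed_le (by fun_prop) continuous_const).measurableSet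
  filter_upwards [Filter.eventually_all.2 h] with ω hω
  rw [Finset.abs_prod]
  exact Finset.prod_le_prod (fun _ _ => abs_nonneg _) fun k _ => hω k

theorem measurable_prod_inner (hLip : ∀ k, LipschitzWith 1 (f k))
    (x : Fin r → EuclideanSpace ℝ (Fin d)) :
    Measurable fun v : EuclideanSpace ℝ (Fin d) => ∏ k, f k (inner ℝ v (x k)) := by
  have hf := fun k => (hLip k).continuous
  exact Continuous.measurable (by fun_prop)

theorem integrable_prod_inner [IsFiniteMeasure μ] (hn : 1 ≤ n)
    (hident : ∀ i, IdentDistrib (A i) a μ μ) (hLip : ∀ k, LipschitzWith 1 (f k))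
    (hB : ∀ k, ∀ x : EuclideanSpace ℝ (Fin d), ‖x‖ ≤ 1 →
      ∀ i, ∀ᵐ ω ∂μ, |f k (inner ℝ (A i ω) x)| ≤ B k)
    (x : Fin r → EuclideanSpace ℝ (Fin d)) (hx : ∀ k, ‖x k‖ ≤ 1) :
    Integrable (fun ω => ∏ k, f k (inner ℝ (a ω) (x k))) μ :=
  Integrable.of_bound ((measurable_prod_inner hLip x).comp_aemeasurable
    (hident ⟨0, hn⟩).aemeasurable_snd).aestronglyMeasurable _
    (ae_abs_prod_le hn hident hLip hB x hx)

/-- Bernstein tail of an increment of `centeredMean` between tuples at `S`-distance at most `δ`. -/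
theorem centeredMean_sub_tail [IsProbabilityMeasure μ] (hr : 2 ≤ r) (hn : 1 ≤ n)
    {S : Matrix (Fin d) (Fin d) ℝ} (hS : S.PosDef)
    (hindep : iIndepFun A μ) (hident : ∀ i, IdentDistrib (A i) a μ μ)
    (hsub : IsSubgaussianVector S a μ) (hLip : ∀ k, LipschitzWith 1 (f k))
    (hf0 : ∀ k, f k 0 = 0) (hBpos : ∀ k, 0 < B k)
    (hB : ∀ k, ∀ x : EuclideanSpace ℝ (Fin d), ‖x‖ ≤ 1 →
      ∀ i, ∀ᵐ ω ∂μ, |f k (inner ℝ (A i ω) x)| ≤ B k)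
    {s δ : ℝ} (hs : 0 < s) (hδ : 0 < δ) (y z : Fin r → EuclideanSpace ℝ (Fin d))
    (hy : ∀ k, ‖y k‖ ≤ 1) (hz : ∀ k, ‖z k‖ ≤ 1)
    (hqy : ∀ k, (y k).ofLp ⬝ᵥ (S *ᵥ (y k).ofLp) ≤ s ^ 2)
    (hqz : ∀ k, (z k).ofLp ⬝ᵥ (S *ᵥ (z k).ofLp) ≤ s ^ 2)
    (hqyz : ∀ k, (y k - z k).ofLp ⬝ᵥ (S *ᵥ (y k - z k).ofLp) ≤ δ ^ 2) {u : ℝ} (hu : 0 < u) :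
    μ.real {ω | 2 * √(u * ((r * s ^ (r - 1) * δ) ^ 2 * (3 * (r.factorial * (24 * r : ℝ) ^ r))) / n)
        + 48 * r * u * ((2 * ∏ k, B k) ^ (1 - 2 / (r : ℝ)) *
          (r * s ^ (r - 1) * δ) ^ (2 / (r : ℝ))) / n
      ≤ centeredMean μ f a A y ω - centeredMean μ f a A z ω} ≤ Real.exp (-u) := by
  have hr0 : (0 : ℝ) < r := by positivity
  have ha : AEMeasurable a μ := (hident ⟨0, hn⟩).aemeasurable_snd
  have hBp : 0 < ∏ k, B k := Finset.prod_pos fun k _ => hBpos k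
  set K : ℝ := r * s ^ (r - 1) * δ with hK
  have hK0 : 0 < K := by positivity
  set M : ℝ := (2 * ∏ k, B k) ^ (1 - 2 / (r : ℝ)) * K ^ (2 / (r : ℝ)) with hM
  have hM0 : 0 < M := by positivity
  -- There are `3r` standardized forms, and `lintegral_exp_sum_sq_le` divides by four times their
  -- number.
  set c : ℝ := (12 * r : ℝ)⁻¹ with hc
  have hc0 : 0 < c := by positivity
  let φ : EuclideanSpace ℝ (Fin d) → ℝ := fun v =>
    ∏ k, f k (inner ℝ v (y k)) - ∏ k, f k (inner ℝ v (z k))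
  have hφ : Measurable φ := (measurable_prod_inner hLip y).sub (measurable_prod_inner hLip z)
  have hiy := integrable_prod_inner hn hident hLip hB y hy
  have hiz := integrable_prod_inner hn hident hLip hB z hz
  -- Each factor contributes its two arguments at scale `s` and their difference at scale `δ`, so
  -- one `Q` controls both sizes and increments.
  let w : Fin r × Fin 3 → EuclideanSpace ℝ (Fin d) := fun p =>
    ![s⁻¹ • y p.1, s⁻¹ • z p.1, δ⁻¹ • (y p.1 - z p.1)] p.2
  let Q : Ω → ℝ := fun ω => ∑ p, (inner ℝ (a ω) (w p)) ^ 2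
  have hQm : AEMeasurable Q μ := by
    have : Measurable fun v : EuclideanSpace ℝ (Fin d) => ∑ p, (inner ℝ v (w p)) ^ 2 :=
      Continuous.measurable (by fun_prop)
    exact this.comp_aemeasurable ha
  have hQ0 : ∀ ω, 0 ≤ Q ω := fun ω => Finset.sum_nonneg fun _ _ => sq_nonneg _
  have hquad : ∀ {τ : ℝ} (x : EuclideanSpace ℝ (Fin d)), 0 < τ →
      x.ofLp ⬝ᵥ (S *ᵥ x.ofLp) ≤ τ ^ 2 →
      (τ⁻¹ • x).ofLp ⬝ᵥ (S *ᵥ (τ⁻¹ • x).ofLp) ≤ 1 ^ 2 := fun {τ} x hτ hx => by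
    simp only [WithLp.ofLp_smul, Matrix.mulVec_smul, smul_dotProduct, dotProduct_smul, smul_eq_mul]
    rw [← mul_assoc, ← mul_inv, ← sq, inv_mul_le_iff₀ (by positivity)]
    linarith
  have hw : ∀ p, (w p).ofLp ⬝ᵥ (S *ᵥ (w p).ofLp) ≤ 1 ^ 2 := by
    rintro ⟨k, j⟩
    fin_cases j
    · exact hquad (y k) hs (hqy k)
    · exact hquad (z k) hs (hqz k)
    · exact hquad (y k - z k) hδ (hqyz k)
  have hQle : ∀ ω p, (inner ℝ (a ω) (w p)) ^ 2 ≤ Q ω := fun ω p =>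
    Finset.single_le_sum (f := fun p => (inner ℝ (a ω) (w p)) ^ 2) (fun _ _ => sq_nonneg _)
      (Finset.mem_univ p)
  have hexp : ∫⁻ ω, ENNReal.ofReal (Real.exp (c * Q ω)) ∂μ ≤ 3 := by
    have : Nonempty (Fin r) := ⟨⟨0, by omega⟩⟩
    have := lintegral_exp_sum_sq_le (μ := μ) (g := fun p ω => inner ℝ (a ω) (w p))
      (fun p => by fun_prop)
      fun p t ht => by
        have := hsub.tail_div hS (w p) one_pos (hw p) ht
        simpa using this
    have hcard : (4 * (Fintype.card (Fin r × Fin 3) : ℝ))⁻¹ = c := by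
      simp [hc]; ring
    rw [hcard] at this
    exact this
  have hXK : ∀ ω, φ (a ω) ^ 2 ≤ K ^ 2 * Q ω ^ r := fun ω => by
    refine sq_prod_sub_prod_le (by omega) hLip hf0 hs hδ (hQ0 ω) _ _ (fun k => ?_) (fun k => ?_)
      fun k => ?_
    · have := hQle ω (k, 0)
      simpa [w, inner_smul_right] using this
    · have := hQle ω (k, 1)
      simpa [w, inner_smul_right] using this
    · have := hQle ω (k, 2)
      simpa [w, inner_smul_right, inner_sub_right] using this
  have hXM : ∀ᵐ ω ∂μ, |φ (a ω)| ≤ M * Q ω := by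
    filter_upwards [ae_abs_prod_le hn hident hLip hB y hy, ae_abs_prod_le hn hident hLip hB z hz]
      with ω h1 h2
    exact abs_le_rpow_mul_of_sq_le hr hK0.le (hQ0 ω) ((abs_sub _ _).trans (by linarith)) (hXK ω)
  have hB := bernstein_of_mgf_le (μ := μ) hn (Y := fun i ω => φ (A i ω)) (X := fun ω => φ (a ω))
    (hindep.comp (fun _ => φ) fun _ => hφ) (fun i => (hident i).comp hφ)
    (V := K ^ 2 * (3 * (r.factorial * (2 / c) ^ r))) (θ₀ := c / (2 * M)) (u := u)
    (by positivity) (by positivity) hu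
    (fun θ h0 h1 => mgf_le_of_dominated (hiy.sub hiz) hQm r hc0 h0 hQ0 hXK hXM hexp (by
      rw [le_div_iff₀ (by positivity)] at h1; linarith))
  refine le_trans (le_of_eq ?_) hB
  congr 1
  ext ω
  have hlhs : 2 * √(u * (K ^ 2 * (3 * (r.factorial * (24 * r : ℝ) ^ r))) / n) + 48 * r * u * M / n =
      2 * √(u * (K ^ 2 * (3 * (r.factorial * (2 / c) ^ r))) / n) + 2 * u / (n * (c / (2 * M))) := by
    have h1 : 2 / c = 24 * r := by rw [hc]; field_simp; norm_num
    have h2 : 2 * u / (n * (c / (2 * M))) = 48 * r * u * M / n := by rw [hc]; field_simp; norm_num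
    rw [h1, h2]
  have hrhs : centeredMean μ f a A y ω - centeredMean μ f a A z ω =
      (1 / (n : ℝ)) * ∑ i, (φ (A i ω) - ∫ ω', φ (a ω') ∂μ) := by
    simp only [centeredMean, φ]
    rw [integral_sub hiy hiz, ← mul_sub, ← Finset.sum_sub_distrib]
    congr 1
    exact Finset.sum_congr rfl fun i _ => by ring
  simp only [Set.mem_ofPred_eq]
  rw [hlhs, hrhs]

end

/-! ### Entropy sums over dyadic scales -/

/-- Each surviving term times `1 - q` is at most a decrement of `min (q ^ j) R`, so the sum
telescopes. -/
theorem sum_geometric_lt_le {q R : ℝ} (hq0 : 0 < q) (hq1 : q < 1) (hR : 0 ≤ R) (N : ℕ) :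
    ∑ j ∈ Finset.range N, (if q ^ j < R then q ^ j else 0) ≤ R / (1 - q) := by
  rw [le_div_iff₀ (by linarith), Finset.sum_mul]
  have h : ∀ j ∈ Finset.range N, (if q ^ j < R then q ^ j else 0) * (1 - q) ≤
      min (q ^ j) R - min (q ^ (j + 1)) R := fun j _ => by
    have h1 : q ^ (j + 1) ≤ q ^ j := pow_le_pow_of_le_one hq0.le hq1.le (Nat.le_succ j)
    split_ifs with hj
    · rw [min_eq_left hj.le, min_eq_left (h1.trans hj.le), pow_succ]; linarith
    · rw [zero_mul, sub_nonneg]; exact min_le_min_right R h1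
  refine (Finset.sum_le_sum h).trans ?_
  rw [Finset.sum_range_sub' (fun j => min (q ^ j) R)]
  have h1 : min (q ^ 0) R ≤ R := min_le_right _ _
  have h2 : 0 ≤ min (q ^ N) R := le_min (by positivity) hR
  linarith

/-- Logarithm of the size of the net of an ellipsoid with semi-axes `ρ` at scale `2⁻ʲ`. -/
noncomputable def ellipsoidEntropy {d : ℕ} (ρ : Fin d → ℝ) (j : ℕ) : ℝ :=
  ∑ i, if (1 / 2 : ℝ) ^ j < ρ i then Real.log (3 * ρ i / (1 / 2 : ℝ) ^ j) else 0

theorem log_three_mul_div_nonneg {x ρ : ℝ} (hx : 0 < x) (h : x < ρ) :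
    0 ≤ Real.log (3 * ρ / x) :=
  Real.log_nonneg ((one_le_div hx).2 (by linarith))

theorem ellipsoidEntropy_nonneg {d : ℕ} (ρ : Fin d → ℝ) (j : ℕ) : 0 ≤ ellipsoidEntropy ρ j := by
  refine Finset.sum_nonneg fun i _ => ?_
  split_ifs with h
  exacts [log_three_mul_div_nonneg (by positivity) h, le_rfl]

theorem ellipsoidEntropy_le {d : ℕ} {ρ : Fin d → ℝ} (hρ : ∀ i, ρ i ≤ 1) (j : ℕ) :
    ellipsoidEntropy ρ j ≤ d * (2 + j) := by
  calc ellipsoidEntropy ρ j ≤ ∑ _i : Fin d, (2 + j : ℝ) := by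
        refine Finset.sum_le_sum fun i _ => ?_
        split_ifs with h
        · have hx : (0 : ℝ) < (1 / 2 : ℝ) ^ j := by positivity
          have hρ0 := hx.trans h
          have h1 : 3 * ρ i / (1 / 2 : ℝ) ^ j ≤ 3 * 2 ^ j := by
            rw [div_le_iff₀ hx, mul_assoc, ← mul_pow]
            norm_num
            exact hρ i
          have h2 : Real.log (3 * 2 ^ j) = Real.log 3 + j * Real.log 2 := by
            rw [Real.log_mul (by norm_num) (by positivity), Real.log_pow]
          have h3 := Real.log_le_sub_one_of_pos (show (0 : ℝ) < 3 by norm_num)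
          have h4 := Real.log_le_sub_one_of_pos (show (0 : ℝ) < 2 by norm_num)
          have h5 : (j : ℝ) * Real.log 2 ≤ j * 1 := by gcongr; linarith
          linarith [Real.log_le_log (by positivity) h1]
        · positivity
    _ = _ := by simp [mul_add]

/-- After exchanging sums, a single axis sees only scales `x = 2^(-j)` below `ρ`. There the
logarithm is at most a multiple of `(ρ/x)^(p/2)`, leaving a geometric series in `x^(p/2)` dominated
by its largest term, of order `ρ^(p/2)`. -/
theorem exists_sum_rpow_mul_entropy_le {p : ℝ} (hp : 0 < p) :
    ∃ C : ℝ, 0 < C ∧ ∀ (d : ℕ) (ρ : Fin d → ℝ), (∀ i, 0 ≤ ρ i) → ∀ N : ℕ,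
      ∑ j ∈ Finset.range N, ((1 / 2 : ℝ) ^ j) ^ p *
        (ellipsoidEntropy ρ j + ellipsoidEntropy ρ (j + 1)) ≤ C * ∑ i, ρ i ^ p := by
  set q : ℝ := (1 / 2 : ℝ) ^ (p / 2) with hq
  have hq0 : 0 < q := by positivity
  have hq1 : q < 1 := Real.rpow_lt_one (by norm_num) (by norm_num) (by positivity)
  have hq1' : 0 < 1 - q := by linarith
  set c : ℝ := 3 ^ (p / 2) / (p / 2) with hc
  have hc0 : 0 < c := by positivity
  have hone : ∀ ρ : ℝ, 0 ≤ ρ → ∀ N : ℕ, ∑ j ∈ Finset.range N, ((1 / 2 : ℝ) ^ j) ^ p *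
      (if (1 / 2 : ℝ) ^ j < ρ then Real.log (3 * ρ / (1 / 2 : ℝ) ^ j) else 0) ≤
      c / (1 - q) * ρ ^ p := fun ρ hρ N => by
    have hterm : ∀ j ∈ Finset.range N, ((1 / 2 : ℝ) ^ j) ^ p *
        (if (1 / 2 : ℝ) ^ j < ρ then Real.log (3 * ρ / (1 / 2 : ℝ) ^ j) else 0) ≤
        c * ρ ^ (p / 2) * (if q ^ j < ρ ^ (p / 2) then q ^ j else 0) := fun j _ => by
      have hqj : q ^ j = ((1 / 2 : ℝ) ^ j) ^ (p / 2) := by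
        rw [hq, ← Real.rpow_natCast, ← Real.rpow_mul (by norm_num), mul_comm, Real.rpow_mul
          (by norm_num), Real.rpow_natCast]
      set x : ℝ := (1 / 2 : ℝ) ^ j
      have hx : 0 < x := by positivity
      by_cases h : x < ρ
      · rw [if_pos h, hqj, if_pos (Real.rpow_lt_rpow hx.le h (by positivity))]
        have h1 := Real.log_le_rpow_div (x := 3 * ρ / x) (by positivity) (half_pos hp)
        calc x ^ p * Real.log (3 * ρ / x) ≤ x ^ p * ((3 * ρ / x) ^ (p / 2) / (p / 2)) := by gcongr
          _ = x ^ (p / 2) * x ^ (p / 2) * (3 ^ (p / 2) * ρ ^ (p / 2) / x ^ (p / 2) / (p / 2)) := by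
              rw [← Real.rpow_add hx, add_halves, Real.div_rpow (by positivity) hx.le,
                Real.mul_rpow (by norm_num) hρ]
          _ = c * ρ ^ (p / 2) * x ^ (p / 2) := by rw [hc]; field_simp
      · rw [if_neg h, mul_zero]
        split_ifs <;> positivity
    refine (Finset.sum_le_sum hterm).trans ?_
    rw [← Finset.mul_sum]
    calc _ ≤ c * ρ ^ (p / 2) * (ρ ^ (p / 2) / (1 - q)) := by
          gcongr
          exact sum_geometric_lt_le hq0 hq1 (by positivity) N
      _ = c / (1 - q) * (ρ ^ (p / 2) * ρ ^ (p / 2)) := by ring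
      _ = _ := by rw [← Real.rpow_add_of_nonneg hρ (by positivity) (by positivity), add_halves]
  have hsum : ∀ (d : ℕ) (ρ : Fin d → ℝ), (∀ i, 0 ≤ ρ i) → ∀ N : ℕ,
      ∑ j ∈ Finset.range N, ((1 / 2 : ℝ) ^ j) ^ p * ellipsoidEntropy ρ j ≤
        c / (1 - q) * ∑ i, ρ i ^ p := fun d ρ hρ N => by
    simp only [ellipsoidEntropy, Finset.mul_sum]
    rw [Finset.sum_comm]
    refine Finset.sum_le_sum fun i _ => hone (ρ i) (hρ i) N
  refine ⟨c / (1 - q) + 2 ^ p * (c / (1 - q)), by positivity, fun d ρ hρ N => ?_⟩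
  have h2 : ∑ j ∈ Finset.range N, ((1 / 2 : ℝ) ^ j) ^ p * ellipsoidEntropy ρ (j + 1) ≤
      2 ^ p * (c / (1 - q) * ∑ i, ρ i ^ p) := by
    have h3 := hsum d ρ hρ (N + 1)
    rw [Finset.sum_range_succ'] at h3
    have h4 : 0 ≤ ((1 / 2 : ℝ) ^ 0) ^ p * ellipsoidEntropy ρ 0 :=
      mul_nonneg (by positivity) (ellipsoidEntropy_nonneg ρ 0)
    have h5 : ∀ j ∈ Finset.range N, ((1 / 2 : ℝ) ^ j) ^ p * ellipsoidEntropy ρ (j + 1) =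
        2 ^ p * (((1 / 2 : ℝ) ^ (j + 1)) ^ p * ellipsoidEntropy ρ (j + 1)) := fun j _ => by
      rw [← mul_assoc, ← Real.mul_rpow (by norm_num) (by positivity)]
      congr 2
      rw [pow_succ]; ring
    rw [Finset.sum_congr rfl h5, ← Finset.mul_sum]
    gcongr
    linarith
  simp only [mul_add, Finset.sum_add_distrib]
  nlinarith [hsum d ρ hρ N]

theorem exists_sum_pow_mul_succ_le {q : ℝ} (hq0 : 0 ≤ q) (hq1 : q < 1) :
    ∃ C : ℝ, 0 < C ∧ ∀ N : ℕ, ∑ j ∈ Finset.range N, q ^ j * ((j : ℝ) + 1) ≤ C := by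
  have hs : Summable fun j : ℕ => q ^ j * ((j : ℝ) + 1) := by
    have h1 := summable_pow_mul_geometric_of_norm_lt_one (r := q) 1
      (by rwa [Real.norm_eq_abs, abs_of_nonneg hq0])
    have h2 := summable_geometric_of_lt_one hq0 hq1
    refine (h1.add h2).congr fun j => by ring
  refine ⟨∑' j : ℕ, q ^ j * ((j : ℝ) + 1) + 1, ?_, fun N => ?_⟩
  · have : 0 ≤ ∑' j : ℕ, q ^ j * ((j : ℝ) + 1) := tsum_nonneg fun j => by positivity
    linarith
  · have := hs.sum_le_tsum (Finset.range N) fun j _ => by positivity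
    linarith

theorem exists_sum_pow_mul_sqrt_entropy_le :
    ∃ C : ℝ, 0 < C ∧ ∀ (d : ℕ) (ρ : Fin d → ℝ), (∀ i, 0 ≤ ρ i) → (∀ i, ρ i ≤ 1) →
      1 ≤ ∑ i, ρ i ^ (2 : ℝ) → ∀ N : ℕ,
      ∑ j ∈ Finset.range N, (1 / 2 : ℝ) ^ j *
        √(ellipsoidEntropy ρ j + ellipsoidEntropy ρ (j + 1)) ≤
          C * √((∑ i, ρ i ^ (2 : ℝ)) * (1 + Real.log d)) := by
  obtain ⟨C₁, hC₁, h₁⟩ := exists_sum_rpow_mul_entropy_le (p := 2) two_pos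
  set q : ℝ := √(1 / 2) with hq
  have hq2 : q ^ 2 = 1 / 2 := Real.sq_sqrt (by norm_num)
  have hq1 : q < 1 := by rw [hq, Real.sqrt_lt' one_pos]; norm_num
  obtain ⟨C₂, hC₂, h₂⟩ := exists_sum_pow_mul_succ_le (Real.sqrt_nonneg _) hq1
  refine ⟨√(4 * C₁) + √5 * C₂, by positivity, fun d ρ hρ0 hρ1 hD N => ?_⟩
  set D := ∑ i, ρ i ^ (2 : ℝ)
  set G : ℕ → ℝ := fun j => ellipsoidEntropy ρ j + ellipsoidEntropy ρ (j + 1) with hG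
  have hG0 : ∀ j, 0 ≤ G j := fun j =>
    add_nonneg (ellipsoidEntropy_nonneg ρ j) (ellipsoidEntropy_nonneg ρ _)
  have hd : (1 : ℝ) ≤ d := by
    rcases Nat.eq_zero_or_pos d with rfl | h
    · simp [D] at hD; linarith
    · exact_mod_cast h
  have hlog : 0 ≤ Real.log d := Real.log_nonneg hd
  have hGle : ∀ j, G j ≤ 5 * d * (j + 1) := fun j => by
    have h1 := ellipsoidEntropy_le hρ1 j
    have h2 := ellipsoidEntropy_le hρ1 (j + 1)
    push_cast at h2
    have h3 : (0 : ℝ) ≤ d * j := by positivity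
    simp only [hG]
    nlinarith
  -- Up to `J`, Cauchy–Schwarz on at most `J + 1` terms reduces to the case `p = 2`. Beyond `J`,
  -- half of the decay `2^(-j)` cancels the factor `√d` in the crude entropy bound.
  set J : ℕ := ⌈Real.log d / Real.log 2⌉₊ with hJ
  have hl2 : 1 / 2 < Real.log 2 := by linarith [Real.log_two_gt_d9]
  have hJd : (d : ℝ) ≤ 2 ^ J := by
    have h1 : Real.log d / Real.log 2 ≤ J := Nat.le_ceil _
    rw [div_le_iff₀ (by linarith), ← Real.log_pow] at h1
    exact (Real.log_le_log_iff (by linarith) (by positivity)).1 h1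
  have hJle : (J : ℝ) + 1 ≤ 4 * (1 + Real.log d) := by
    have h1 : (J : ℝ) < Real.log d / Real.log 2 + 1 := Nat.ceil_lt_add_one (by positivity)
    have h2 : Real.log d / Real.log 2 ≤ 2 * Real.log d := by
      rw [div_le_iff₀ (by linarith)]; nlinarith
    linarith
  have hterm : ∀ j ∈ Finset.range N, (1 / 2 : ℝ) ^ j * √(G j) ≤
      (if j < J + 1 then (1 / 2 : ℝ) ^ j * √(G j) else 0) + √5 * (q ^ j * (j + 1)) := fun j _ => by
    have h0 : 0 ≤ √5 * (q ^ j * ((j : ℝ) + 1)) := by positivity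
    split_ifs with h
    · linarith
    · rw [zero_add]
      have hdq : (d : ℝ) * (q ^ j) ^ 2 ≤ 1 := by
        rw [← pow_mul, mul_comm j, pow_mul, hq2, one_div, inv_pow, ← div_eq_mul_inv,
          div_le_one (by positivity)]
        exact hJd.trans (pow_le_pow_right₀ one_le_two (by omega))
      refine le_of_sq_le_sq ?_ h0
      have hqj : (1 / 2 : ℝ) ^ j = (q ^ j) ^ 2 := by rw [← pow_mul, mul_comm j, pow_mul, hq2]
      rw [mul_pow, Real.sq_sqrt (hG0 j), hqj, mul_pow, Real.sq_sqrt (by norm_num), mul_pow]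
      have hj : (1 : ℝ) ≤ j + 1 := by linarith [Nat.cast_nonneg (α := ℝ) j]
      calc ((q ^ j) ^ 2) ^ 2 * G j ≤ ((q ^ j) ^ 2) ^ 2 * (5 * d * (j + 1)) := by
            gcongr; exact hGle j
        _ = 5 * ((q ^ j) ^ 2 * (j + 1)) * (d * (q ^ j) ^ 2) := by ring
        _ ≤ 5 * ((q ^ j) ^ 2 * (j + 1)) * 1 := by gcongr
        _ ≤ 5 * ((q ^ j) ^ 2 * (j + 1) ^ 2) := by
            rw [mul_one]; gcongr; nlinarith
  have hfirst : ∑ j ∈ Finset.range N, (if j < J + 1 then (1 / 2 : ℝ) ^ j * √(G j) else 0) ≤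
      √(4 * C₁) * √(D * (1 + Real.log d)) := by
    rw [← Finset.sum_filter, ← Real.sqrt_mul (by positivity)]
    refine Real.le_sqrt_of_sq_le ((sq_sum_le_card_mul_sum_sq).trans ?_)
    have hcard : (((Finset.range N).filter (· < J + 1)).card : ℝ) ≤ J + 1 := by
      have : (Finset.range N).filter (· < J + 1) ⊆ Finset.range (J + 1) := fun j hj =>
        Finset.mem_range.2 (Finset.mem_filter.1 hj).2
      have := Finset.card_le_card this
      rw [Finset.card_range] at this
      exact_mod_cast this
    have hs : ∑ j ∈ (Finset.range N).filter (· < J + 1), ((1 / 2 : ℝ) ^ j * √(G j)) ^ 2 ≤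
        C₁ * D := by
      refine le_trans ?_ (h₁ d ρ hρ0 N)
      refine (Finset.sum_le_sum_of_subset_of_nonneg (Finset.filter_subset _ _)
        fun _ _ _ => sq_nonneg _).trans (le_of_eq (Finset.sum_congr rfl fun j _ => ?_))
      rw [mul_pow, Real.sq_sqrt (hG0 j), Real.rpow_two]
    calc _ ≤ ((J : ℝ) + 1) * (C₁ * D) := by gcongr
      _ ≤ (4 * (1 + Real.log d)) * (C₁ * D) := by gcongr
      _ = _ := by ring
  have hsecond : ∑ j ∈ Finset.range N, √5 * (q ^ j * ((j : ℝ) + 1)) ≤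
      √5 * C₂ * √(D * (1 + Real.log d)) := by
    rw [← Finset.mul_sum, mul_assoc]
    gcongr
    refine (h₂ N).trans (le_mul_of_one_le_right hC₂.le ?_)
    rw [Real.one_le_sqrt]
    nlinarith
  calc _ ≤ _ := Finset.sum_le_sum hterm
    _ ≤ _ := by rw [Finset.sum_add_distrib, add_mul]; exact add_le_add hfirst hsecond

theorem exists_chaining_sums_le {r : ℕ} (hr : 2 ≤ r) :
    ∃ C : ℝ, 0 < C ∧ ∀ (d : ℕ) (ρ : Fin d → ℝ), (∀ i, 0 ≤ ρ i) → (∀ i, ρ i ≤ 1) →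
      (∃ i, ρ i = 1) → ∀ lam : ℝ, 0 < lam → (2 ≤ d ∨ 1 ≤ lam) → ∀ N : ℕ,
      ∑ j ∈ Finset.range N, (1 / 2 : ℝ) ^ j *
        √(lam + r * (ellipsoidEntropy ρ j + ellipsoidEntropy ρ (j + 1)) + (j + 1)) ≤
          C * (√lam + √((∑ i, ρ i ^ (2 : ℝ)) * Real.log d)) ∧
      ∑ j ∈ Finset.range N, ((1 / 2 : ℝ) ^ j) ^ (2 / (r : ℝ)) *
        (lam + r * (ellipsoidEntropy ρ j + ellipsoidEntropy ρ (j + 1)) + (j + 1)) ≤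
          C * (lam + (∑ i, ρ i ^ (2 / (r : ℝ))) * Real.log d) := by
  have hr0 : (0 : ℝ) < r := by positivity
  obtain ⟨C₁, hC₁, h₁⟩ := exists_sum_rpow_mul_entropy_le (p := 2 / (r : ℝ)) (by positivity)
  obtain ⟨C₂, hC₂, h₂⟩ := exists_sum_pow_mul_sqrt_entropy_le
  obtain ⟨C₃, hC₃, h₃⟩ := exists_sum_pow_mul_succ_le (q := 1 / 2) (by norm_num) (by norm_num)
  set q : ℝ := (1 / 2 : ℝ) ^ (2 / (r : ℝ)) with hq
  have hq0 : 0 < q := by positivity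
  have hq1 : q < 1 := Real.rpow_lt_one (by norm_num) (by norm_num) (by positivity)
  obtain ⟨C₄, hC₄, h₄⟩ := exists_sum_pow_mul_succ_le hq0.le hq1
  refine ⟨2 * (C₃ + r * C₂ + C₃) + 3 * (C₄ + r * C₁ + C₄), by positivity,
    fun d ρ hρ0 hρ1 ⟨i₀, hi₀⟩ lam hlam hdl N => ?_⟩
  have hd1 : 1 ≤ d := by have := i₀.isLt; omega
  have hlog : 0 ≤ Real.log d := Real.log_nonneg (by exact_mod_cast hd1)
  have hD1 : ∀ p : ℝ, 1 ≤ ∑ i, ρ i ^ p := fun p => by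
    have := Finset.single_le_sum (f := fun i => ρ i ^ p)
      (fun i _ => Real.rpow_nonneg (hρ0 i) p) (Finset.mem_univ i₀)
    simpa [hi₀] using this
  -- For `d ≥ 2`, `1 ≤ 2 ln d`, so `1 + ln d` may be replaced by `3 ln d`. For `d = 1` the logarithm
  -- vanishes and the leftover constant is absorbed by `lam ≥ 1`.
  have habs : ∀ p : ℝ, 0 ≤ p → (∑ i, ρ i ^ p) * (1 + Real.log d) ≤
      3 * ((∑ i, ρ i ^ p) * Real.log d) ∨
      (∑ i, ρ i ^ p) * (1 + Real.log d) ≤ lam ∧ 1 ≤ lam := fun p hp => by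
    rcases Nat.lt_or_ge d 2 with hd | hd
    · have hl : 1 ≤ lam := hdl.resolve_left (by omega)
      refine Or.inr ⟨?_, hl⟩
      have h1 : ∑ i, ρ i ^ p ≤ d := by
        calc ∑ i, ρ i ^ p ≤ ∑ _i : Fin d, (1 : ℝ) :=
              Finset.sum_le_sum fun i _ => Real.rpow_le_one (hρ0 i) (hρ1 i) hp
          _ = d := by simp
      have h2 : (d : ℝ) = 1 := by exact_mod_cast (show d = 1 by omega)
      rw [h2] at h1 ⊢
      simpa using h1.trans hl
    · left
      have h1 : Real.log 2 ≤ Real.log d := Real.log_le_log two_pos (by exact_mod_cast hd)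
      have h2 : 1 ≤ 2 * Real.log d := by linarith [Real.log_two_gt_d9]
      nlinarith [hD1 p]
  set G : ℕ → ℝ := fun j => ellipsoidEntropy ρ j + ellipsoidEntropy ρ (j + 1) with hG
  have hG0 : ∀ j, 0 ≤ G j := fun j =>
    add_nonneg (ellipsoidEntropy_nonneg ρ j) (ellipsoidEntropy_nonneg ρ _)
  have hgeom : ∀ (x : ℝ) (C : ℝ), 0 ≤ x → (∀ N : ℕ, ∑ j ∈ Finset.range N, x ^ j * ((j : ℝ) + 1) ≤ C)
      → ∑ j ∈ Finset.range N, x ^ j ≤ C := fun x C hx h => by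
    refine (Finset.sum_le_sum fun j _ => ?_).trans (h N)
    exact le_mul_of_one_le_right (by positivity) (by linarith [Nat.cast_nonneg (α := ℝ) j])
  constructor
  · set D := ∑ i, ρ i ^ (2 : ℝ) with hD
    have hterm : ∀ j ∈ Finset.range N, (1 / 2 : ℝ) ^ j * √(lam + r * G j + (j + 1)) ≤
        √lam * (1 / 2 : ℝ) ^ j + r * ((1 / 2 : ℝ) ^ j * √(G j)) + (1 / 2 : ℝ) ^ j * (j + 1) :=
      fun j _ => by
        have hj : (0 : ℝ) ≤ j := Nat.cast_nonneg j
        have h5 : √(lam + r * G j + (j + 1)) ≤ √lam + r * √(G j) + (j + 1) := by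
          have := hG0 j
          refine Real.sqrt_le_iff.2 ⟨by positivity, ?_⟩
          have e1 := Real.sq_sqrt hlam.le
          have e2 := Real.sq_sqrt this
          have e3 : (r : ℝ) * G j ≤ (r * √(G j)) ^ 2 := by
            rw [mul_pow, e2]
            have : (1 : ℝ) ≤ r := by exact_mod_cast (by omega : 1 ≤ r)
            gcongr
            nlinarith
          have p1 : 0 ≤ √lam * (r * √(G j)) := by positivity
          have p2 : 0 ≤ √lam * (j + 1) := by positivity
          have p3 : 0 ≤ (r * √(G j)) * (j + 1) := by positivity
          nlinarith
        calc _ ≤ (1 / 2 : ℝ) ^ j * (√lam + r * √(G j) + (j + 1)) := by gcongr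
          _ = _ := by ring
    have hsum : ∑ j ∈ Finset.range N, (1 / 2 : ℝ) ^ j * √(lam + r * G j + (j + 1)) ≤
        √lam * C₃ + r * (C₂ * √(D * (1 + Real.log d))) + C₃ := by
      refine (Finset.sum_le_sum hterm).trans ?_
      rw [Finset.sum_add_distrib, Finset.sum_add_distrib, ← Finset.mul_sum, ← Finset.mul_sum]
      gcongr
      · exact hgeom _ _ (by norm_num) h₃
      · exact h₂ d ρ hρ0 hρ1 (hD1 2) N
      · exact h₃ N
    have hW : 1 ≤ √(D * (1 + Real.log d)) := by
      rw [Real.one_le_sqrt]; nlinarith [hD1 2]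
    have hWle : √lam + √(D * (1 + Real.log d)) ≤ 2 * (√lam + √(D * Real.log d)) := by
      rcases habs 2 (by norm_num) with h | ⟨h, -⟩
      · have : √(D * (1 + Real.log d)) ≤ 2 * √(D * Real.log d) := by
          have h4 : 0 ≤ D * Real.log d := mul_nonneg (by linarith [hD1 2]) hlog
          refine Real.sqrt_le_iff.2 ⟨by positivity, ?_⟩
          rw [mul_pow, Real.sq_sqrt h4]
          linarith
        linarith [Real.sqrt_nonneg lam]
      · have : √(D * (1 + Real.log d)) ≤ √lam := Real.sqrt_le_sqrt h
        linarith [Real.sqrt_nonneg (D * Real.log d)]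
    have hS0 := Real.sqrt_nonneg lam
    calc _ ≤ _ := hsum
      _ ≤ (C₃ + r * C₂ + C₃) * (√lam + √(D * (1 + Real.log d))) := by
          have : 0 ≤ r * C₂ * √lam := by positivity
          nlinarith
      _ ≤ (C₃ + r * C₂ + C₃) * (2 * (√lam + √(D * Real.log d))) := by gcongr
      _ ≤ _ := by
          have : 0 ≤ 3 * (C₄ + r * C₁ + C₄) * (√lam + √(D * Real.log d)) := by positivity
          linarith
  · set D := ∑ i, ρ i ^ (2 / (r : ℝ)) with hD
    have hD1' : 1 ≤ D := hD1 _
    have hxq : ∀ j : ℕ, ((1 / 2 : ℝ) ^ j) ^ (2 / (r : ℝ)) = q ^ j := fun j => by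
      rw [hq, ← Real.rpow_natCast, ← Real.rpow_mul (by norm_num), mul_comm, Real.rpow_mul
          (by norm_num), Real.rpow_natCast]
    have hsum : ∑ j ∈ Finset.range N, ((1 / 2 : ℝ) ^ j) ^ (2 / (r : ℝ)) *
        (lam + r * G j + (j + 1)) ≤ lam * C₄ + r * (C₁ * D) + C₄ := by
      have : ∀ j ∈ Finset.range N, ((1 / 2 : ℝ) ^ j) ^ (2 / (r : ℝ)) * (lam + r * G j + (j + 1)) =
          lam * q ^ j + r * (((1 / 2 : ℝ) ^ j) ^ (2 / (r : ℝ)) * G j) + q ^ j * (j + 1) :=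
        fun j _ => by rw [hxq]; ring
      rw [Finset.sum_congr rfl this, Finset.sum_add_distrib, Finset.sum_add_distrib,
        ← Finset.mul_sum, ← Finset.mul_sum]
      gcongr
      · exact hgeom _ _ hq0.le h₄
      · exact h₁ d ρ hρ0 N
      · exact h₄ N
    have hWle : lam + D * (1 + Real.log d) ≤ 3 * (lam + D * Real.log d) := by
      have h4 : 0 ≤ D * Real.log d := by positivity
      rcases habs (2 / (r : ℝ)) (by positivity) with h | ⟨h, -⟩ <;> linarith
    have hDl : D ≤ D * (1 + Real.log d) := le_mul_of_one_le_right (by linarith) (by linarith)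
    calc _ ≤ _ := hsum
      _ ≤ (C₄ + r * C₁ + C₄) * (lam + D * (1 + Real.log d)) := by
          have e1 : 0 ≤ r * C₁ * lam := by positivity
          have e2 : 0 ≤ C₄ * lam := by positivity
          have e3 : r * C₁ * D ≤ r * C₁ * (D * (1 + Real.log d)) := by gcongr
          have e4 : C₄ * 1 ≤ C₄ * (D * (1 + Real.log d)) := by gcongr; linarith
          have e5 : 0 ≤ C₄ * (D * (1 + Real.log d)) := by positivity
          nlinarith
      _ ≤ (C₄ + r * C₁ + C₄) * (3 * (lam + D * Real.log d)) := by gcongr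
      _ ≤ _ := by
          have : 0 ≤ 2 * (C₃ + r * C₂ + C₃) * (lam + D * Real.log d) := by positivity
          linarith

/-! ### Spectral form, dyadic nets and the union bound -/

theorem Matrix.IsHermitian.dotProduct_mulVec_eq_sum {d : ℕ} {S : Matrix (Fin d) (Fin d) ℝ}
    (hS : S.IsHermitian) (x : EuclideanSpace ℝ (Fin d)) :
    x.ofLp ⬝ᵥ (S *ᵥ x.ofLp) =
      ∑ i, hS.eigenvalues i * (hS.eigenvectorBasis.repr x i) ^ 2 := by
  have h1 := hS.eigenvectorBasis.sum_inner_mul_inner x (WithLp.toLp 2 (S *ᵥ x.ofLp))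
  have h2 : inner ℝ x (WithLp.toLp 2 (S *ᵥ x.ofLp)) = x.ofLp ⬝ᵥ (S *ᵥ x.ofLp) := by
    rw [EuclideanSpace.inner_eq_star_dotProduct, dotProduct_comm]; simp
  rw [← h2, ← h1]
  refine Finset.sum_congr rfl fun i _ => ?_
  have h3 : inner ℝ (hS.eigenvectorBasis i) (WithLp.toLp 2 (S *ᵥ x.ofLp)) =
      hS.eigenvalues i * inner ℝ (hS.eigenvectorBasis i) x := by
    rw [EuclideanSpace.inner_eq_star_dotProduct, EuclideanSpace.inner_eq_star_dotProduct,
      star_trivial, dotProduct_comm, Matrix.dotProduct_mulVec, ← Matrix.mulVec_transpose]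
    have hT : Sᵀ = S := by
      rw [← Matrix.conjTranspose_eq_transpose_of_trivial]; exact hS
    rw [hT, hS.mulVec_eigenvectorBasis, smul_dotProduct, dotProduct_comm]
    rfl
  rw [h3, hS.eigenvectorBasis.repr_apply_apply, real_inner_comm]
  ring

/-- Nets of the unit ball at all dyadic scales, for a quadratic form with given spectrum. -/
theorem exists_dyadic_nets {d : ℕ}
    (b : OrthonormalBasis (Fin d) ℝ (EuclideanSpace ℝ (Fin d))) (σ : Fin d → ℝ) {s : ℝ}
    (hs : 0 < s) (hσ0 : ∀ i, 0 ≤ σ i) (hσs : ∀ i, σ i ≤ s) :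
    ∃ T : ℕ → Finset (EuclideanSpace ℝ (Fin d)), T 0 = {0} ∧ ∀ j, (∀ y ∈ T j, ‖y‖ ≤ 1) ∧
      ((T j).card : ℝ) ≤ Real.exp (ellipsoidEntropy (fun i => σ i / s) j) ∧
      ∀ x, ‖x‖ ≤ 1 → ∃ y ∈ T j,
        ∑ i, (σ i * b.repr (x - y) i) ^ 2 ≤ (3 * (s * (1 / 2 : ℝ) ^ j)) ^ 2 := by
  choose T hT using fun j : ℕ =>
    exists_ellipsoid_net b σ hσ0 (ε := s * (1 / 2 : ℝ) ^ j) (by positivity)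
  -- The coarsest net is reduced to the origin, where the process vanishes and every chain starts.
  -- It suffices since the ball has radius at most `s` for the seminorm.
  refine ⟨fun j => if j = 0 then {0} else T j, by simp, fun j => ?_⟩
  rcases eq_or_ne j 0 with rfl | hj
  · refine ⟨by simp, by simpa using ellipsoidEntropy_nonneg _ 0, fun x hx => ⟨0, by simp, ?_⟩⟩
    have hnorm : ∑ i, (b.repr x i) ^ 2 ≤ 1 := by
      have h1 : ∑ i, (b.repr x i) ^ 2 = ‖x‖ ^ 2 := by
        rw [← b.repr.norm_map x, EuclideanSpace.norm_sq_eq]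
        simp
      rw [h1]
      exact pow_le_one₀ (norm_nonneg _) hx
    calc ∑ i, (σ i * b.repr (x - 0) i) ^ 2 ≤ ∑ i, s ^ 2 * (b.repr x i) ^ 2 := by
          refine Finset.sum_le_sum fun i _ => ?_
          rw [sub_zero, mul_pow]
          gcongr
          exacts [hσ0 i, hσs i]
      _ = s ^ 2 * ∑ i, (b.repr x i) ^ 2 := by rw [Finset.mul_sum]
      _ ≤ s ^ 2 * 1 := by gcongr
      _ ≤ _ := by nlinarith [sq_nonneg s]
  · simp only [if_neg hj]
    obtain ⟨h1, h2, h3⟩ := hT j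
    refine ⟨h1, h2.trans (le_of_eq ?_), h3⟩
    rw [ellipsoidEntropy, Real.exp_sum]
    refine Finset.prod_congr rfl fun i _ => ?_
    have hx : (0 : ℝ) < (1 / 2 : ℝ) ^ j := by positivity
    have hiff : s * (1 / 2 : ℝ) ^ j < σ i ↔ (1 / 2 : ℝ) ^ j < σ i / s := by
      rw [lt_div_iff₀ hs, mul_comm]
    by_cases h : s * (1 / 2 : ℝ) ^ j < σ i
    · rw [if_pos h, if_pos (hiff.1 h), Real.exp_log]
      · field_simp
      · have : 0 < σ i := lt_trans (by positivity) h
        positivity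
    · rw [if_neg h, if_neg (hiff.not.1 h), Real.exp_zero]

/-- Union bound along the links of a chain. -/
theorem measure_chain_le {α Ω : Type*} [MeasurableSpace Ω] {μ : Measure Ω} [IsFiniteMeasure μ]
    {X : α → Ω → ℝ} {T : ℕ → Finset α} {R : ℕ → α → α → Prop} {t u : ℕ → ℝ} {lam W : ℝ}
    (h0 : ∀ x ∈ T 0, ∀ ω, X x ω = 0)
    (htail : ∀ j, ∀ y ∈ T (j + 1), ∀ z ∈ T j, R j y z →
      μ.real {ω | t j ≤ X y ω - X z ω} ≤ Real.exp (-u j))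
    (hcard : ∀ j, ((T (j + 1)).card : ℝ) * (T j).card ≤ Real.exp (u j - lam - (j + 1)))
    (hW : ∀ N, ∑ j ∈ Finset.range N, t j ≤ W) :
    μ {ω | ∃ π : ℕ → α, (∀ j, π j ∈ T j) ∧ (∀ j, R j (π (j + 1)) (π j)) ∧ ∃ N, W < X (π N) ω} ≤
      ENNReal.ofReal (Real.exp (-lam)) := by
  classical
  let U : ℕ → Set Ω := fun j => ⋃ p ∈ (T (j + 1) ×ˢ T j).filter (fun p => R j p.1 p.2),
    {ω | t j ≤ X p.1 ω - X p.2 ω}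
  have hsub : {ω | ∃ π : ℕ → α, (∀ j, π j ∈ T j) ∧ (∀ j, R j (π (j + 1)) (π j)) ∧
      ∃ N, W < X (π N) ω} ⊆ ⋃ j, U j := by
    rintro ω ⟨π, hπ, hR, N, hN⟩
    by_contra hcon
    have hlt : ∀ j, X (π (j + 1)) ω - X (π j) ω < t j := fun j => by
      by_contra hge
      refine hcon (Set.mem_iUnion.2 ⟨j, Set.mem_iUnion₂.2 ⟨(π (j + 1), π j), ?_, not_lt.1 hge⟩⟩)
      simp [hπ, hR]
    have hle : X (π N) ω ≤ ∑ j ∈ Finset.range N, t j := by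
      have h1 := Finset.sum_range_sub (fun j => X (π j) ω) N
      have h2 : ∑ j ∈ Finset.range N, (X (π (j + 1)) ω - X (π j) ω) ≤ ∑ j ∈ Finset.range N, t j :=
        Finset.sum_le_sum fun j _ => (hlt j).le
      rw [h1, h0 _ (hπ 0) ω] at h2
      linarith
    linarith [hW N]
  have hU : ∀ j, μ (U j) ≤ ENNReal.ofReal (Real.exp (-lam) / 2 / 2 ^ j) := fun j => by
    have h1 : ∀ p ∈ (T (j + 1) ×ˢ T j).filter (fun p => R j p.1 p.2),
        μ {ω | t j ≤ X p.1 ω - X p.2 ω} ≤ ENNReal.ofReal (Real.exp (-u j)) := fun p hp => by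
      obtain ⟨hp1, hp2⟩ := Finset.mem_filter.1 hp
      obtain ⟨hy, hz⟩ := Finset.mem_product.1 hp1
      rw [← ofReal_measureReal]
      exact ENNReal.ofReal_le_ofReal (htail j p.1 hy p.2 hz hp2)
    refine (measure_biUnion_finset_le _ _).trans ((Finset.sum_le_sum h1).trans ?_)
    rw [Finset.sum_const, nsmul_eq_mul, ← ENNReal.ofReal_natCast,
      ← ENNReal.ofReal_mul (by positivity)]
    refine ENNReal.ofReal_le_ofReal ?_
    have hc : (((T (j + 1) ×ˢ T j).filter (fun p => R j p.1 p.2)).card : ℝ) ≤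
        (T (j + 1)).card * (T j).card := by
      rw [← Nat.cast_mul, ← Finset.card_product]
      exact_mod_cast Finset.card_filter_le _ _
    calc _ ≤ Real.exp (u j - lam - (j + 1)) * Real.exp (-u j) := by
          gcongr; exact hc.trans (hcard j)
      _ = Real.exp (-lam) * (Real.exp ((j + 1 : ℕ) * 1))⁻¹ := by
          rw [← Real.exp_neg, ← Real.exp_add, ← Real.exp_add]; push_cast; ring_nf
      -- Using `e ≥ 2` gives failure probabilities that sum exactly to `exp (-lam)`.
      _ ≤ Real.exp (-lam) * ((2 : ℝ) ^ (j + 1))⁻¹ := by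
          rw [Real.exp_nat_mul]
          gcongr
          linarith [Real.add_one_le_exp (1 : ℝ)]
      _ = _ := by rw [pow_succ]; field_simp
  calc _ ≤ μ (⋃ j, U j) := measure_mono hsub
    _ ≤ ∑' j, μ (U j) := measure_iUnion_le _
    _ ≤ ∑' j : ℕ, ENNReal.ofReal (Real.exp (-lam) / 2 / 2 ^ j) := ENNReal.tsum_le_tsum hU
    _ = ENNReal.ofReal (Real.exp (-lam)) := by
        rw [← ENNReal.ofReal_tsum_of_nonneg (fun j => by positivity) (summable_geometric_two' _),
          tsum_geometric_two']

/-! ### Finiteness and continuity of the process -/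

section
variable {r d n : ℕ} {Ω : Type*} [MeasurableSpace Ω] {μ : Measure Ω}
  {f : Fin r → ℝ → ℝ} {a : Ω → EuclideanSpace ℝ (Fin d)} {A : Fin n → Ω → EuclideanSpace ℝ (Fin d)}
  {B : Fin r → ℝ}

/-- The bound `‖A i ω‖ ^ r` from the Lipschitz condition holds at every `ω`, whereas the exceptional
null sets of the `B k` depend on the point. The `B k` serve only for the expectation. -/
theorem bddAbove_range_centeredMean [IsProbabilityMeasure μ] (hn : 1 ≤ n)
    (hident : ∀ i, IdentDistrib (A i) a μ μ) (hLip : ∀ k, LipschitzWith 1 (f k))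
    (hf0 : ∀ k, f k 0 = 0)
    (hB : ∀ k, ∀ x : EuclideanSpace ℝ (Fin d), ‖x‖ ≤ 1 →
      ∀ i, ∀ᵐ ω ∂μ, |f k (inner ℝ (A i ω) x)| ≤ B k) (ω : Ω) :
    BddAbove (Set.range fun x : BallTuple r d => centeredMean μ f a A x.1 ω) := by
  refine ⟨(1 / (n : ℝ)) * ∑ i, (‖A i ω‖ ^ r + ∏ k, B k), ?_⟩
  rintro _ ⟨x, rfl⟩
  simp only [centeredMean]
  gcongr with i
  have h1 : ∏ k, f k (inner ℝ (A i ω) (x.1 k)) ≤ ‖A i ω‖ ^ r := by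
    refine (le_abs_self _).trans ?_
    rw [Finset.abs_prod]
    calc ∏ k, |f k (inner ℝ (A i ω) (x.1 k))| ≤ ∏ _k : Fin r, ‖A i ω‖ := by
          refine Finset.prod_le_prod (fun _ _ => abs_nonneg _) fun k _ => ?_
          have h2 : |f k (inner ℝ (A i ω) (x.1 k))| ≤ |inner ℝ (A i ω) (x.1 k)| := by
            simpa [Real.dist_eq, hf0] using (hLip k).dist_le_mul (inner ℝ (A i ω) (x.1 k)) 0
          refine h2.trans ((abs_real_inner_le_norm _ _).trans ?_)
          exact mul_le_of_le_one_right (norm_nonneg _) (x.2 k)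
      _ = _ := by simp
  have h2 : |∫ ω', ∏ k, f k (inner ℝ (a ω') (x.1 k)) ∂μ| ≤ ∏ k, B k := by
    have := norm_integral_le_of_norm_le_const (μ := μ)
      (f := fun ω' => ∏ k, f k (inner ℝ (a ω') (x.1 k)))
      (ae_abs_prod_le hn hident hLip hB x.1 x.2)
    simpa using this
  linarith [neg_abs_le (∫ ω', ∏ k, f k (inner ℝ (a ω') (x.1 k)) ∂μ)]

/-- Lets values along a chain reach the limit tuple. The expectation passes to the limit by
dominated convergence. -/
theorem tendsto_centeredMean [IsProbabilityMeasure μ] (hn : 1 ≤ n)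
    (hident : ∀ i, IdentDistrib (A i) a μ μ) (hLip : ∀ k, LipschitzWith 1 (f k))
    (hB : ∀ k, ∀ x : EuclideanSpace ℝ (Fin d), ‖x‖ ≤ 1 →
      ∀ i, ∀ᵐ ω ∂μ, |f k (inner ℝ (A i ω) x)| ≤ B k)
    {π : ℕ → Fin r → EuclideanSpace ℝ (Fin d)} {x : Fin r → EuclideanSpace ℝ (Fin d)}
    (hπ : ∀ j k, ‖π j k‖ ≤ 1) (hlim : Filter.Tendsto π Filter.atTop (nhds x)) (ω : Ω) :
    Filter.Tendsto (fun j => centeredMean μ f a A (π j) ω) Filter.atTop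
      (nhds (centeredMean μ f a A x ω)) := by
  have hf := fun k => (hLip k).continuous
  have hcont : ∀ v : EuclideanSpace ℝ (Fin d), Filter.Tendsto
      (fun j => ∏ k, f k (inner ℝ v (π j k))) Filter.atTop (nhds (∏ k, f k (inner ℝ v (x k)))) :=
    fun v => by
      have : Continuous fun x : Fin r → EuclideanSpace ℝ (Fin d) => ∏ k, f k (inner ℝ v (x k)) := by
        fun_prop
      exact (this.tendsto x).comp hlim
  have hint : Filter.Tendsto (fun j => ∫ ω', ∏ k, f k (inner ℝ (a ω') (π j k)) ∂μ) Filter.atTop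
      (nhds (∫ ω', ∏ k, f k (inner ℝ (a ω') (x k)) ∂μ)) :=
    tendsto_integral_of_dominated_convergence (fun _ => ∏ k, B k)
      (fun j => ((measurable_prod_inner hLip (π j)).comp_aemeasurable
        (hident ⟨0, hn⟩).aemeasurable_snd).aestronglyMeasurable) (integrable_const _)
      (fun j => ae_abs_prod_le hn hident hLip hB (π j) (hπ j))
      (Filter.Eventually.of_forall fun ω' => hcont (a ω'))
  exact (tendsto_finsetSum _ fun i _ => (hcont (A i ω)).sub hint).const_mul _

end

/-- Strict positivity of the weights makes the seminorm a norm. The rate degrades with the smallest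
weight, but only convergence is used. -/
theorem tendsto_of_weighted_sq_le {d : ℕ}
    (b : OrthonormalBasis (Fin d) ℝ (EuclideanSpace ℝ (Fin d))) {σ : Fin d → ℝ}
    (hσ : ∀ i, 0 < σ i) {s : ℝ} {π : ℕ → EuclideanSpace ℝ (Fin d)} {x : EuclideanSpace ℝ (Fin d)}
    (h : ∀ j, ∑ i, (σ i * b.repr (x - π j) i) ^ 2 ≤ (3 * (s * (1 / 2 : ℝ) ^ j)) ^ 2) :
    Filter.Tendsto π Filter.atTop (nhds x) := by
  have hpow : Filter.Tendsto (fun j : ℕ => (1 / 2 : ℝ) ^ j) Filter.atTop (nhds 0) :=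
    tendsto_pow_atTop_nhds_zero_of_lt_one (by norm_num) (by norm_num)
  have hco : ∀ i, Filter.Tendsto (fun j => b.repr (π j) i) Filter.atTop (nhds (b.repr x i)) :=
    fun i => by
      rw [tendsto_iff_dist_tendsto_zero]
      have hz : Filter.Tendsto (fun j : ℕ => 3 * (|s| * (1 / 2 : ℝ) ^ j) / σ i) Filter.atTop
          (nhds 0) := by
        simpa using ((hpow.const_mul |s|).const_mul 3).div_const (σ i)
      refine squeeze_zero (fun _ => dist_nonneg) (fun j => ?_) hz
      have h1 : (σ i * b.repr (x - π j) i) ^ 2 ≤ (3 * (s * (1 / 2 : ℝ) ^ j)) ^ 2 :=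
        (Finset.single_le_sum (f := fun i => (σ i * b.repr (x - π j) i) ^ 2)
          (fun _ _ => sq_nonneg _) (Finset.mem_univ i)).trans (h j)
      have h2 := sq_le_sq.1 h1
      rw [abs_mul, abs_of_pos (hσ i), abs_mul, abs_mul, abs_of_pos (show (0 : ℝ) < 3 by norm_num),
        abs_of_pos (show (0 : ℝ) < (1 / 2 : ℝ) ^ j by positivity)] at h2
      rw [dist_comm, Real.dist_eq, le_div_iff₀ (hσ i), mul_comm]
      simpa using h2
  have hx : ∀ y, y = ∑ i, b.repr y i • b i := fun y => (b.sum_repr y).symm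
  rw [hx x, show π = fun j => ∑ i, b.repr (π j) i • b i from funext fun j => hx (π j)]
  exact tendsto_finsetSum _ fun i _ => (hco i).smul_const (b i)

/-! ### Summation along the chain -/

/-- Homogeneity: with `B = s^r b`, both parts of the Bernstein threshold scale as `s^r`, and the
powers of `2^(-j)` left are `1` and `2/r`. -/
theorem chaining_threshold_le {r : ℕ} (hr : 2 ≤ r) {s b V n : ℝ} (hs : 0 < s) (hb : 0 < b)
    (hn : 0 < n) (hV : 0 ≤ V) {u : ℕ → ℝ} {C P Q : ℝ}
    (hP : ∀ N, ∑ j ∈ Finset.range N, (1 / 2 : ℝ) ^ j * √(u j) ≤ C * P)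
    (hQ : ∀ N, ∑ j ∈ Finset.range N, ((1 / 2 : ℝ) ^ j) ^ (2 / (r : ℝ)) * u j ≤ C * Q) (N : ℕ) :
    ∑ j ∈ Finset.range N, (2 * √(u j * ((r * s ^ (r - 1) * (6 * (s * (1 / 2 : ℝ) ^ j))) ^ 2 * V) / n)
        + 48 * r * u j * ((2 * (s ^ r * b)) ^ (1 - 2 / (r : ℝ)) *
          (r * s ^ (r - 1) * (6 * (s * (1 / 2 : ℝ) ^ j))) ^ (2 / (r : ℝ))) / n) ≤
      s ^ r * (12 * r * √V * C * (P / √n) +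
        48 * r * (2 ^ (1 - 2 / (r : ℝ)) * (6 * r) ^ (2 / (r : ℝ))) * C *
          ((1 / n) * (Q / b ^ (2 / (r : ℝ) - 1)))) := by
  have hr0 : (0 : ℝ) < r := by positivity
  have hK : ∀ j : ℕ, r * s ^ (r - 1) * (6 * (s * (1 / 2 : ℝ) ^ j)) =
      6 * r * s ^ r * (1 / 2 : ℝ) ^ j := fun j => by
    obtain ⟨m, rfl⟩ := Nat.exists_eq_add_of_le' (by omega : 1 ≤ r)
    rw [Nat.add_sub_cancel, pow_succ]
    ring
  have hb' : b ^ (1 - 2 / (r : ℝ)) = (b ^ (2 / (r : ℝ) - 1))⁻¹ := by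
    rw [← Real.rpow_neg hb.le, neg_sub]
  have hterm : ∀ j ∈ Finset.range N,
      (2 * √(u j * ((r * s ^ (r - 1) * (6 * (s * (1 / 2 : ℝ) ^ j))) ^ 2 * V) / n)
        + 48 * r * u j * ((2 * (s ^ r * b)) ^ (1 - 2 / (r : ℝ)) *
          (r * s ^ (r - 1) * (6 * (s * (1 / 2 : ℝ) ^ j))) ^ (2 / (r : ℝ))) / n) =
      12 * r * √V * s ^ r / √n * ((1 / 2 : ℝ) ^ j * √(u j)) +
      48 * r * (2 ^ (1 - 2 / (r : ℝ)) * (6 * r) ^ (2 / (r : ℝ))) * s ^ r * (1 / n) *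
        (b ^ (2 / (r : ℝ) - 1))⁻¹ * (((1 / 2 : ℝ) ^ j) ^ (2 / (r : ℝ)) * u j) := fun j _ => by
    rw [hK]
    have h1 : √(u j * ((6 * r * s ^ r * (1 / 2 : ℝ) ^ j) ^ 2 * V) / n) =
        6 * r * s ^ r * (1 / 2 : ℝ) ^ j * (√V * √(u j)) / √n := by
      rw [Real.sqrt_div' _ hn.le, show u j * ((6 * r * s ^ r * (1 / 2 : ℝ) ^ j) ^ 2 * V) =
        (6 * r * s ^ r * (1 / 2 : ℝ) ^ j) ^ 2 * (V * u j) by ring,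
        Real.sqrt_mul (sq_nonneg _), Real.sqrt_sq (by positivity), Real.sqrt_mul hV]
    have h2 : (2 * (s ^ r * b)) ^ (1 - 2 / (r : ℝ)) *
        (6 * r * s ^ r * (1 / 2 : ℝ) ^ j) ^ (2 / (r : ℝ)) =
        (2 ^ (1 - 2 / (r : ℝ)) * (6 * r) ^ (2 / (r : ℝ))) * s ^ r *
          (b ^ (2 / (r : ℝ) - 1))⁻¹ * ((1 / 2 : ℝ) ^ j) ^ (2 / (r : ℝ)) := by
      have hx : (0 : ℝ) < (1 / 2 : ℝ) ^ j := by positivity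
      have hsr : (s ^ r) ^ (1 - 2 / (r : ℝ)) * (s ^ r) ^ (2 / (r : ℝ)) = s ^ r := by
        rw [← Real.rpow_add (by positivity)]; simp
      rw [Real.mul_rpow (x := 2) (by norm_num) (by positivity),
        Real.mul_rpow (x := s ^ r) (by positivity) hb.le,
        Real.mul_rpow (y := (1 / 2 : ℝ) ^ j) (by positivity) hx.le,
        Real.mul_rpow (x := 6 * (r : ℝ)) (by positivity) (by positivity), hb']
      conv_rhs => rw [← hsr]
      ring
    rw [h1, h2]
    ring
  rw [Finset.sum_congr rfl hterm, Finset.sum_add_distrib, ← Finset.mul_sum, ← Finset.mul_sum]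
  calc _ ≤ 12 * r * √V * s ^ r / √n * (C * P) +
      48 * r * (2 ^ (1 - 2 / (r : ℝ)) * (6 * r) ^ (2 / (r : ℝ))) * s ^ r * (1 / n) *
        (b ^ (2 / (r : ℝ) - 1))⁻¹ * (C * Q) := by
        gcongr
        exacts [hP N, hQ N]
    _ = _ := by ring

theorem exists_spectral_weights {d : ℕ} (hd : 1 ≤ d) {S : Matrix (Fin d) (Fin d) ℝ}
    (hS : S.PosDef) :
    ∃ (b : OrthonormalBasis (Fin d) ℝ (EuclideanSpace ℝ (Fin d))) (σ : Fin d → ℝ),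
      (∀ i, 0 < σ i) ∧ (∀ i, σ i ≤ sigmaMax hS.posSemidef) ∧ (∃ i, σ i = sigmaMax hS.posSemidef) ∧
      (∀ x : EuclideanSpace ℝ (Fin d),
        x.ofLp ⬝ᵥ (S *ᵥ x.ofLp) = ∑ i, (σ i * b.repr x i) ^ 2) ∧
      ∀ m : ℕ, effDim hS.posSemidef m =
        ∑ i, (σ i / sigmaMax hS.posSemidef) ^ (2 / (m : ℝ)) := by
  have hdne : Nonempty (Fin d) := ⟨⟨0, hd⟩⟩
  have hev0 : ∀ i, 0 < hS.posSemidef.isHermitian.eigenvalues i := fun i => hS.eigenvalues_pos i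
  refine ⟨hS.posSemidef.isHermitian.eigenvectorBasis,
    fun i => √(hS.posSemidef.isHermitian.eigenvalues i), fun i => Real.sqrt_pos.2 (hev0 i),
    fun i => Real.sqrt_le_sqrt (le_ciSup (Set.finite_range _).bddAbove i), ?_, fun x => ?_,
    fun m => rfl⟩
  · obtain ⟨i, hi⟩ := exists_eq_ciSup_of_finite (f := hS.posSemidef.isHermitian.eigenvalues)
    exact ⟨i, congrArg Real.sqrt hi⟩
  · rw [hS.posSemidef.isHermitian.dotProduct_mulVec_eq_sum]
    refine Finset.sum_congr rfl fun i _ => ?_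
    rw [mul_pow, Real.sq_sqrt (hev0 i).le]

theorem sum_sq_weighted_le_of_norm_le_one {d : ℕ}
    (b : OrthonormalBasis (Fin d) ℝ (EuclideanSpace ℝ (Fin d))) {σ : Fin d → ℝ} {s : ℝ}
    (hσ0 : ∀ i, 0 ≤ σ i) (hσs : ∀ i, σ i ≤ s) {x : EuclideanSpace ℝ (Fin d)} (hx : ‖x‖ ≤ 1) :
    ∑ i, (σ i * b.repr x i) ^ 2 ≤ s ^ 2 := by
  have hnorm : ∑ i, (b.repr x i) ^ 2 = ‖x‖ ^ 2 := by
    rw [← b.repr.norm_map x, EuclideanSpace.norm_sq_eq]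
    simp
  calc ∑ i, (σ i * b.repr x i) ^ 2 ≤ ∑ i, s ^ 2 * (b.repr x i) ^ 2 := by
        refine Finset.sum_le_sum fun i _ => ?_
        rw [mul_pow]
        exact mul_le_mul_of_nonneg_right (pow_le_pow_left₀ (hσ0 i) (hσs i) 2) (sq_nonneg _)
    _ = s ^ 2 * ‖x‖ ^ 2 := by rw [← Finset.mul_sum, hnorm]
    _ ≤ s ^ 2 * 1 := by gcongr; exact pow_le_one₀ (norm_nonneg _) hx
    _ = s ^ 2 := mul_one _

theorem sum_sq_weighted_sub_le {d : ℕ}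
    (b : OrthonormalBasis (Fin d) ℝ (EuclideanSpace ℝ (Fin d))) (σ : Fin d → ℝ) {η : ℝ}
    {x y z : EuclideanSpace ℝ (Fin d)}
    (hz : ∑ i, (σ i * b.repr (x - z) i) ^ 2 ≤ (3 * η) ^ 2)
    (hy : ∑ i, (σ i * b.repr (x - y) i) ^ 2 ≤ (3 * (η * (1 / 2))) ^ 2) :
    ∑ i, (σ i * b.repr (y - z) i) ^ 2 ≤ (6 * η) ^ 2 := by
  have h3 : ∑ i, (σ i * b.repr (y - z) i) ^ 2 ≤
      2 * ∑ i, (σ i * b.repr (x - z) i) ^ 2 + 2 * ∑ i, (σ i * b.repr (x - y) i) ^ 2 := by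
    rw [Finset.mul_sum, Finset.mul_sum, ← Finset.sum_add_distrib]
    refine Finset.sum_le_sum fun i _ => ?_
    simp only [map_sub, PiLp.sub_apply]
    nlinarith [sq_nonneg (σ i * (b.repr x i - b.repr z i) + σ i * (b.repr x i - b.repr y i))]
  nlinarith [sq_nonneg η]

/-! ### Proof of the theorem -/

theorem theorem1 (r : ℕ) (hr : 2 ≤ r) :
    ∃ C : ℝ, 0 < C ∧
      ∀ (d n : ℕ) (_hd : 1 ≤ d) (_hn : 1 ≤ n)
        (S : Matrix (Fin d) (Fin d) ℝ) (hS : S.PosDef)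
        (Ω : Type*) (_ : MeasurableSpace Ω) (μ : Measure Ω) (_ : IsProbabilityMeasure μ)
        (a : Ω → EuclideanSpace ℝ (Fin d)) (A : Fin n → Ω → EuclideanSpace ℝ (Fin d))
        (_hindep : iIndepFun A μ) (_hident : ∀ i, IdentDistrib (A i) a μ μ)
        (_hsub : IsSubgaussianVector S a μ)
        (f : Fin r → ℝ → ℝ) (_hLip : ∀ k, LipschitzWith 1 (f k)) (_hf0 : ∀ k, f k 0 = 0)
        (B : Fin r → ℝ) (_hBpos : ∀ k, 0 < B k)
        (_hB : ∀ k, ∀ x : EuclideanSpace ℝ (Fin d), ‖x‖ ≤ 1 →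
          ∀ i, ∀ᵐ ω ∂μ, |f k (inner ℝ (A i ω) x)| ≤ B k),
        -- the expectations and the supremum in the definition of `Z` are well defined
        (∀ x : BallTuple r d, Integrable (fun ω => ∏ k, f k (inner ℝ (a ω) (x.1 k))) μ) ∧
        (∀ ω, BddAbove (Set.range fun x : BallTuple r d => centeredMean μ f a A x.1 ω)) ∧
        -- the tail bound
        ∀ lam : ℝ, 0 < lam → (2 ≤ d ∨ 1 ≤ lam) →
          μ.real {ω | C * sigmaMax hS.posSemidef ^ r *
              ((1 / (n : ℝ)) * ((lam + effDim hS.posSemidef r * Real.log d) /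
                  ((sigmaMax hS.posSemidef ^ r)⁻¹ * ∏ k, B k) ^ (2 / (r : ℝ) - 1))
                + (√lam + √(effDim hS.posSemidef 1 * Real.log d)) / √(n : ℝ))
              ≤ centeredSup μ f a A ω}
            ≤ Real.exp (-lam) := by
  obtain ⟨C₀, hC₀, hsums⟩ := exists_chaining_sums_le hr
  have hr0 : (0 : ℝ) < r := by positivity
  set V : ℝ := 3 * (r.factorial * (24 * r : ℝ) ^ r) with hV
  have hV0 : 0 < V := by positivity
  set c₁ : ℝ := 12 * r * √V * C₀ with hc₁
  set c₂ : ℝ := 48 * r * (2 ^ (1 - 2 / (r : ℝ)) * (6 * r) ^ (2 / (r : ℝ))) * C₀ with hc₂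
  have hc₁0 : 0 < c₁ := by positivity
  have hc₂0 : 0 < c₂ := by positivity
  refine ⟨c₁ + c₂, by positivity, ?_⟩
  intro d n hd hn S hS Ω _ μ _ a A hindep hident hsub f hLip hf0 B hBpos hB
  refine ⟨fun x => integrable_prod_inner hn hident hLip hB x.1 x.2,
    bddAbove_range_centeredMean hn hident hLip hf0 hB, fun lam hlam hdl => ?_⟩
  have hn0 : (0 : ℝ) < n := by exact_mod_cast hn
  have hBp : 0 < ∏ k, B k := Finset.prod_pos fun k _ => hBpos k
  obtain ⟨b, σ, hσ0, hσs, ⟨i₀, hi₀⟩, hquad, heff⟩ := exists_spectral_weights hd hS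
  have he1 := heff 1
  have her := heff r
  generalize effDim hS.posSemidef 1 = D₁ at he1 ⊢
  generalize effDim hS.posSemidef r = Dᵣ at her ⊢
  generalize sigmaMax hS.posSemidef = s at *
  have hs : 0 < s := hi₀ ▸ hσ0 i₀
  let ρ : Fin d → ℝ := fun i => σ i / s
  have hρ0 : ∀ i, 0 ≤ ρ i := fun i => div_nonneg (hσ0 i).le hs.le
  have hρ1 : ∀ i, ρ i ≤ 1 := fun i => (div_le_one hs).2 (hσs i)
  have hρe : ∃ i, ρ i = 1 := ⟨i₀, by simp only [ρ, hi₀, div_self hs.ne']⟩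
  have hquad1 : ∀ x : EuclideanSpace ℝ (Fin d), ‖x‖ ≤ 1 → x.ofLp ⬝ᵥ (S *ᵥ x.ofLp) ≤ s ^ 2 :=
    fun x hx => (hquad x).trans_le
      (sum_sq_weighted_le_of_norm_le_one b (fun i => (hσ0 i).le) hσs hx)
  obtain ⟨T, hT0, hT⟩ := exists_dyadic_nets b σ hs (fun i => (hσ0 i).le) hσs
  let TT : ℕ → Finset (Fin r → EuclideanSpace ℝ (Fin d)) := fun j =>
    Fintype.piFinset fun _ => T j
  -- The level pays for the target probability, the number of pairs of net `r`-tuples, and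
  -- summability over the scales.
  let u : ℕ → ℝ := fun j => lam + r * (ellipsoidEntropy ρ j + ellipsoidEntropy ρ (j + 1)) + (j + 1)
  have hu : ∀ j, 0 < u j := fun j => by
    have := ellipsoidEntropy_nonneg ρ j
    have := ellipsoidEntropy_nonneg ρ (j + 1)
    positivity
  let t : ℕ → ℝ := fun j =>
    2 * √(u j * ((r * s ^ (r - 1) * (6 * (s * (1 / 2 : ℝ) ^ j))) ^ 2 * V) / n)
        + 48 * r * u j * ((2 * ∏ k, B k) ^ (1 - 2 / (r : ℝ)) *
          (r * s ^ (r - 1) * (6 * (s * (1 / 2 : ℝ) ^ j))) ^ (2 / (r : ℝ))) / n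
  let R : ℕ → (Fin r → EuclideanSpace ℝ (Fin d)) → (Fin r → EuclideanSpace ℝ (Fin d)) → Prop :=
    fun j y z => ∀ k, (y k - z k).ofLp ⬝ᵥ (S *ᵥ (y k - z k).ofLp) ≤ (6 * (s * (1 / 2 : ℝ) ^ j)) ^ 2
  set P : ℝ := √lam + √(D₁ * Real.log d) with hP
  set Q : ℝ := lam + Dᵣ * Real.log d with hQ
  set β : ℝ := (s ^ r)⁻¹ * ∏ k, B k with hβ
  have hβ0 : 0 < β := by positivity
  have hBβ : ∏ k, B k = s ^ r * β := by rw [hβ, mul_inv_cancel_left₀ (by positivity)]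
  set W : ℝ := s ^ r * (c₁ * (P / √n) + c₂ * ((1 / n) * (Q / β ^ (2 / (r : ℝ) - 1)))) with hW
  have hsum := hsums d ρ hρ0 hρ1 hρe lam hlam hdl
  rw [Nat.cast_one, div_one] at he1
  have htW : ∀ N, ∑ j ∈ Finset.range N, t j ≤ W := fun N => by
    simp only [t, hBβ]
    refine chaining_threshold_le hr hs hβ0 hn0 hV0.le (fun N => ?_)
      (fun N => ?_) N
    · rw [hP, he1]; exact (hsum N).1
    · rw [hQ, her]; exact (hsum N).2
  clear_value c₁ c₂ V
  have hmain := measure_chain_le (μ := μ) (X := fun x ω => centeredMean μ f a A x ω) (T := TT)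
    (R := R) (t := t) (u := u) (lam := lam) (W := W) ?_ ?_ ?_ htW
  · refine ENNReal.toReal_le_of_le_ofReal (Real.exp_pos _).le (le_trans (measure_mono ?_) hmain)
    intro ω hω
    have hPpos : 0 < P := by positivity
    have hlog : 0 ≤ Real.log d := Real.log_nonneg (by exact_mod_cast hd)
    have hQpos : 0 < Q := by
      have : 0 ≤ Dᵣ := by
        rw [her]; exact Finset.sum_nonneg fun i _ => Real.rpow_nonneg (hρ0 i) _
      positivity
    -- The event for `Z` is non-strict, but the choice of a tuple above `W` needs strictness. The
    -- common constant `c₁ + c₂` provides it through positive cross terms.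
    have hWlt : W < centeredSup μ f a A ω := by
      refine lt_of_lt_of_le ?_ hω
      have hp1 : 0 < P / √n := by positivity
      have hp2 : 0 < (1 / (n : ℝ)) * (Q / β ^ (2 / (r : ℝ) - 1)) := by positivity
      have hsr : 0 < s ^ r := by positivity
      rw [hW, mul_comm (c₁ + c₂), mul_assoc]
      refine mul_lt_mul_of_pos_left ?_ hsr
      nlinarith [mul_pos hc₁0 hp2, mul_pos hc₂0 hp1]
    have hne : Nonempty (BallTuple r d) := ⟨⟨0, by simp⟩⟩
    obtain ⟨x, hx⟩ := exists_lt_of_lt_ciSup hWlt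
    -- The tuple `x` depends on `ω`, which is allowed because the bad event covers all chains at
    -- once. Consecutive approximations are compared through `x`, hence the radius `6 s 2^(-j)` in
    -- `R`.
    choose π hπT hπ using fun (j : ℕ) (k : Fin r) => (hT j).2.2 (x.1 k) (x.2 k)
    refine ⟨π, fun j => Fintype.mem_piFinset.2 (hπT j), fun j k => ?_, ?_⟩
    · rw [hquad]
      refine sum_sq_weighted_sub_le b σ (hπ j k) ?_
      have h := hπ (j + 1) k
      rwa [pow_succ (1 / 2 : ℝ), ← mul_assoc s] at h
    · have hlim : Filter.Tendsto π Filter.atTop (nhds x.1) :=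
        tendsto_pi_nhds.2 fun k => tendsto_of_weighted_sq_le b hσ0 fun j => hπ j k
      have htend := tendsto_centeredMean (μ := μ) hn hident hLip hB
        (fun j k => (hT j).1 _ (hπT j k)) hlim ω
      exact (htend.eventually (lt_mem_nhds hx)).exists
  · intro x hx ω
    have hx0 : x = 0 := by
      funext k
      have := Fintype.mem_piFinset.1 hx k
      simpa [hT0] using this
    have hprod : ∏ k, f k 0 = 0 :=
      Finset.prod_eq_zero (Finset.mem_univ (⟨0, by omega⟩ : Fin r)) (hf0 _)
    simp [centeredMean, hx0, hprod]
  · intro j y hy z hz hyz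
    have hy1 : ∀ k, ‖y k‖ ≤ 1 := fun k => (hT (j + 1)).1 _ (Fintype.mem_piFinset.1 hy k)
    have hz1 : ∀ k, ‖z k‖ ≤ 1 := fun k => (hT j).1 _ (Fintype.mem_piFinset.1 hz k)
    have h := centeredMean_sub_tail hr hn hS hindep hident hsub hLip hf0 hBpos hB hs
      (by positivity) y z hy1 hz1 (fun k => hquad1 _ (hy1 k)) (fun k => hquad1 _ (hz1 k)) hyz (hu j)
    rwa [← hV] at h
  · intro j
    have hc : ∀ j, ((TT j).card : ℝ) ≤ Real.exp (r * ellipsoidEntropy ρ j) := fun j => by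
      rw [Fintype.card_piFinset_const, Nat.cast_pow, Real.exp_nat_mul]
      exact pow_le_pow_left₀ (Nat.cast_nonneg _) (hT j).2.1 r
    calc _ ≤ Real.exp (r * ellipsoidEntropy ρ (j + 1)) * Real.exp (r * ellipsoidEntropy ρ j) :=
          mul_le_mul (hc _) (hc _) (Nat.cast_nonneg _) (Real.exp_pos _).le
      _ = _ := by
          rw [← Real.exp_add]
          congr 1
          change _ = lam + r * (ellipsoidEntropy ρ j + ellipsoidEntropy ρ (j + 1)) + (j + 1) - lam -
            (j + 1)
          ring
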